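/- **Setting.** Let $N\ge 2$ players have actions $x_i\in\mathbb R^{n_i}$, let $n=\sum_i n_i\ge 1$, and let the costs be $J_i(x_i,x_{-i})$, $x=(x_1,\dots,x_N)\in\mathbb R^n$. A profile $x^*$ is a Nash equilibrium (NE) if $J_i(x_i^*,x_{-i}^*)\le J_i(y,x_{-i}^*)$ for all $i$ and all $y\in\mathbb R^{n_i}$. Let $\mathcal G$ be an undirected connected graph on the players with symmetric weights $a_{ij}>0$ on edges and $a_{ij}=0$ otherwise, and let $0=\lambda_1<\lambda_2\le\dots\le\lambda_N$ be the eigenvalues of its Laplacian. Assume: 1. for every $i$ and every fixed $x_{-i}$, $J_i(\cdot,x_{-i})$ is continuously differentiable, strictly convex and radially unbounded; 2. $F(x)=\mathrm{col}\{\nabla_iJ_i(x)\}_i$ satisfies $\langle F(x)-F(y),x-y\rangle\ge\mu\|x-y\|^2$ with $\mu>0$, and each $\nabla_iJ_i$ is Lipschitz in $x_i$ with constant $\theta_i$ (uniformly in $x_{-i}$) and Lipschitz in $x_{-i}$ with constant $\theta_{-i}$ (uniformly in $x_i$); put $\theta=\big(\sum_i(\theta_i^2+\theta_{-i}^2)\big)^{1/2}$;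 3. every NE $x^*$ satisfies $\|x^*\|_\infty\le M'$; initial states are restricted to $\|\boldsymbol x^i(0)\|_\infty\le M$ for all $i$; and $M_0=M+M'>0$. **Algorithm.** Player $i$ keeps an estimate $\boldsymbol x^i(t)\in\mathbb R^n$ of all actions. Let $q$ be the odd uniform quantizer with levels $-L,\dots,L$: $q(x)=0$ for $|x|<\frac12$, $q(x)=\min\{\lfloor x+\frac12\rfloor,L\}$ for $x\ge\frac12$, and $q(x)=-q(-x)$ for $x\le-\frac12$; let $Q$ be $q$ applied to each coordinate. With sampling period $T$ and scaling $s(k)$, the decoded values are $\widehat{\boldsymbol x}^j(0)=s(0)Q(\boldsymbol x^j(0)/s(0))$ and $\widehat{\boldsymbol x}^j(kT)=\widehat{\boldsymbol x}^j((k-1)T)+s(k)\,Q\big((\boldsymbol x^j(kT)-\widehat{\boldsymbol x}^j((k-1)T))/s(k)\big)$ for $k\ge1$, held constant on $[kT,(k+1)T)$. The estimates are continuous and follow $$\dot{\boldsymbol x}^i(t)=\alpha\sum_{j=1}^N a_{ij}\big(\widehat{\boldsymbol x}^j(t)-\widehat{\boldsymbol x}^i(t)\big)-R_i\nabla_iJ_i(\boldsymbol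 x^i(t)),\qquad t\ge0,\tag{D}$$ where $R_iv\in\mathbb R^n$ has $i$-th block $\varepsilon v$ and all other blocks $0$ (right derivative at the instants $kT$). **Parameters.** Put $$\nu=2\lambda_{\min}\begin{bmatrix}\mu/N&-\theta/\sqrt N\\-\theta/\sqrt N&\alpha\lambda_2/\varepsilon-\theta\end{bmatrix},\quad \gamma=\frac{\varepsilon\nu\beta}4,\quad \rho=\Big(\frac{\theta\varepsilon}{\alpha\lambda_N}+1\Big)\frac{8\alpha\lambda_N}{\nu^2\beta\varepsilon\sqrt{1-\beta}},$$ $$s(k)=\frac{\varepsilon\nu M_0}{\alpha\lambda_N}\sqrt{1-\beta}\;e^{-\gamma T-\alpha\lambda_NT}\,e^{-\gamma kT}.$$ Call $(\varepsilon,\alpha,\beta,a_1,a_2,T,L)$ *admissible* if $\varepsilon,T>0$, $\alpha>\frac{\varepsilon}{\lambda_2}\big(\frac{\theta^2}\mu+\theta\big)$, $\beta,a_1\in(0,1)$, $0<a_2<1-a_1$, the sampling condition $$(e^{\alpha\lambda_NT}-1)(e^{\gamma T}-1)\rho\,\varepsilon^{-1}\le a_1\tag{a1}$$ holds, and $L$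 is a positive integer with $L\ge\max\Big\{\frac{M_0}{s(0)},\Big\lceil\frac{\sqrt{Nn}\,e^{\gamma T+\alpha\lambda_NT}}{2a_2}-\frac12\Big\rceil\Big\}$. At each instant $kT$ every edge carries $n\log_2(2L+1)$ bits. The bandwidth is $\mathcal B=\max_{(j,i)\in\mathcal E}\limsup_{t\to\infty}\frac1t\sum_{k:\,t_k^{ji}\le t}r_{ji}(k)$, where $r_{ji}(k)$ is the number of bits sent at the sampling instant $t_k^{ji}=kT$. **Theorem.** The game has exactly one NE $x^*$. Say that (D) *converges exponentially to $x^*$ at rate $\gamma$* if $\gamma>0$ and there is a constant $C$ such that from every initial state with $\|\boldsymbol x^i(0)\|_\infty\le M$ for all $i$, (D) has a solution on $[0,\infty)$, and every solution satisfies $\|\boldsymbol x^i(t)-x^*\|\le Ce^{-\gamma t}$ for all $i$ and all $t\ge0$. Then: (i) for every $B>0$ there are admissible parameters for which the bandwidth is exactly $\mathcal B=B$ and (D) converges exponentially to $x^*$ at rate $\gamma$; (ii) for all $c>\frac1{\lambda_2}\big(\frac{\theta^2}\mu+\theta\big)$, $\beta,a_1\in(0,1)$ and $a_2\in(0,1-a_1)$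 there is an integer $L$ such that for every $T>0$ there is $\varepsilon_0>0$ such that for all $\varepsilon\in(0,\varepsilon_0)$ the parameters $(\varepsilon,c\varepsilon,\beta,a_1,a_2,T,L)$ are admissible (in particular (a1) holds), the bandwidth equals $n\log_2(2L+1)/T$, and (D) converges exponentially to $x^*$ at rate $\gamma$. -/

import Mathlib

open Set Filter Topology

namespace QNash

noncomputable section

/-! ### The game -/

/-- The action space `ℝ^{n_i}` of player `i`, with the Euclidean norm. -/
abbrev Action {N : ℕ} (n : Fin N → ℕ) (i : Fin N) : Type := EuclideanSpace ℝ (Fin (n i))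

/-- Action profiles `x = (x_1, …, x_N) ∈ ℝ^n`, `n = ∑ n_i`, with the Euclidean norm. -/
abbrev Profile {N : ℕ} (n : Fin N → ℕ) : Type := PiLp 2 (Action n)

variable {N : ℕ} {n : Fin N → ℕ}

/-- The profile `(y, x_{-i})`. -/
def replace (x : Profile n) (i : Fin N) (y : Action n i) : Profile n :=
  WithLp.toLp 2 (Function.update (fun j => x j) i y)

/-- Nash equilibrium of the game with cost functions `J i (x_i, x_{-i})`. -/
def IsNash (J : Fin N → Profile n → ℝ) (x : Profile n) : Prop :=
  ∀ i, ∀ y : Action n i, J i x ≤ J i (replace x i y)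

/-- The partial gradient `∇_i J_i (x_i, x_{-i})` with respect to player `i`'s own action. -/
def ownGrad (J : Fin N → Profile n → ℝ) (i : Fin N) (x : Profile n) : Action n i :=
  gradient (fun y => J i (replace x i y)) (x i)

/-- The game mapping `F(x) = col {∇_i J_i (x_i, x_{-i})}`. -/
def gameMap (J : Fin N → Profile n → ℝ) (x : Profile n) : Profile n :=
  WithLp.toLp 2 (fun i => ownGrad J i x)

/-- Each cost is, in the player's own action and for any fixed actions of the others,
continuously differentiable, strictly convex and radially unbounded. -/
structure CostAssumption (J : Fin N → Profile n → ℝ) : Prop where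
  contDiff : ∀ i x, ContDiff ℝ 1 (fun y => J i (replace x i y))
  strictConvex : ∀ i x, StrictConvexOn ℝ univ (fun y => J i (replace x i y))
  radiallyUnbounded : ∀ i x,
    Tendsto (fun y => J i (replace x i y)) (Bornology.cobounded (Action n i)) atTop

/-- Strong monotonicity of the game mapping, and Lipschitz continuity of each partial gradient
`∇_i J_i` in `x_i` (constant `θown i`) and in `x_{-i}` (constant `θoth i`). When `x_i = y_i`,
`‖x - y‖ = ‖x_{-i} - y_{-i}‖`. -/
structure MapAssumption (J : Fin N → Profile n → ℝ) (μ : ℝ) (θown θoth : Fin N → ℝ) : Prop where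
  mu_pos : 0 < μ
  own_nonneg : ∀ i, 0 ≤ θown i
  oth_nonneg : ∀ i, 0 ≤ θoth i
  stronglyMonotone : ∀ x y : Profile n,
    μ * ‖x - y‖ ^ 2 ≤ inner ℝ (gameMap J x - gameMap J y) (x - y)
  lipschitz_own : ∀ i (x y : Profile n), (∀ j, j ≠ i → x j = y j) →
    ‖ownGrad J i x - ownGrad J i y‖ ≤ θown i * ‖x i - y i‖
  lipschitz_oth : ∀ i (x y : Profile n), x i = y i →
    ‖ownGrad J i x - ownGrad J i y‖ ≤ θoth i * ‖x - y‖

/-- `‖x‖_∞ ≤ M` for a profile `x`. -/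
def SupBound (M : ℝ) (x : Profile n) : Prop := ∀ i c, |x i c| ≤ M

/-! ### The communication graph -/

/-- An undirected weighted graph on the players: `a_{ij} > 0` on edges, `a_{ij} = 0` otherwise. -/
structure WGraph (N : ℕ) where
  graph : SimpleGraph (Fin N)
  a : Matrix (Fin N) (Fin N) ℝ
  symm : ∀ i j, a i j = a j i
  pos : ∀ i j, graph.Adj i j → 0 < a i j
  zero : ∀ i j, ¬ graph.Adj i j → a i j = 0

/-- The Laplacian matrix: `l_{ij} = -a_{ij}` for `i ≠ j`, `l_{ii} = ∑_{j ≠ i} a_{ij}`. -/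
def WGraph.lap (G : WGraph N) : Matrix (Fin N) (Fin N) ℝ :=
  Matrix.of fun i j => if i = j then ∑ k ∈ Finset.univ.erase i, G.a i k else - G.a i j

theorem WGraph.lap_isHermitian (G : WGraph N) : G.lap.IsHermitian := by
  ext i j
  by_cases h : i = j
  · subst h; simp [WGraph.lap]
  · simp [WGraph.lap, h, Ne.symm h, G.symm i j]

/-- The eigenvalues of a symmetric matrix in ascending order, with multiplicity. -/
def sortedEig {m : ℕ} {A : Matrix (Fin m) (Fin m) ℝ} (hA : A.IsHermitian) (k : Fin m) : ℝ :=
  hA.eigenvalues₀ (Fin.cast (Fintype.card_fin m).symm k.rev)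

/-! ### The adaptive quantizer -/

/-- The scalar uniform quantizer with levels `-L, …, L`. -/
def quant (L : ℕ) (x : ℝ) : ℤ :=
  if -(1 / 2) < x ∧ x < 1 / 2 then 0
  else if 1 / 2 ≤ x then min ⌊x + 1 / 2⌋ (L : ℤ)
  else - min ⌊-x + 1 / 2⌋ (L : ℤ)

/-- A quantized message: one integer per coordinate. -/
abbrev Message {N : ℕ} (n : Fin N → ℕ) : Type := (i : Fin N) → Fin (n i) → ℤ

/-- The encoder: the coordinatewise quantization of `(v - prev) / s`. -/
def encode (L : ℕ) (s : ℝ) (v prev : Profile n) : Message n :=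
  fun i c => quant L ((v i c - prev i c) / s)

/-- A message read as a vector of `ℝ^n`. -/
def Message.toProfile (m : Message n) : Profile n :=
  WithLp.toLp 2 fun i => WithLp.toLp 2 fun c => (m i c : ℝ)

/-- The decoder output after sample `k`, for the samples `y 0, y 1, …` and the scaling `s`. -/
def decoded (L : ℕ) (s : ℕ → ℝ) (y : ℕ → Profile n) : ℕ → Profile n
  | 0 => s 0 • (encode L (s 0) (y 0) 0).toProfile
  | k + 1 => decoded L s y k + s (k + 1) •
      (encode L (s (k + 1)) (y (k + 1)) (decoded L s y k)).toProfile

/-! ### Design parameters -/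

/-- The constants of the problem: number `N` of players, total dimension `n`, monotonicity and
Lipschitz constants `μ, θ`, Laplacian eigenvalues `λ_2, λ_N`, and `M₀ = M + M'`. -/
structure Consts where
  N : ℕ
  n : ℕ
  μ : ℝ
  θ : ℝ
  lam2 : ℝ
  lamN : ℝ
  M₀ : ℝ

/-- `θ = (∑_i (θ_i² + θ_{-i}²))^{1/2}`, a Lipschitz constant of the game mapping and of the
augmented game mapping. -/
def lipConst (θown θoth : Fin N → ℝ) : ℝ := √(∑ i, (θown i ^ 2 + θoth i ^ 2))

/-- The constants attached to a game and a graph with at least two players. -/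
def consts (hN : 2 ≤ N) (n : Fin N → ℕ) (G : WGraph N) (μ : ℝ) (θown θoth : Fin N → ℝ)
    (M M' : ℝ) : Consts where
  N := N
  n := ∑ i, n i
  μ := μ
  θ := lipConst θown θoth
  lam2 := sortedEig G.lap_isHermitian ⟨1, by omega⟩
  lamN := sortedEig G.lap_isHermitian ⟨N - 1, by omega⟩
  M₀ := M + M'

/-- The tunable parameters of the algorithm. -/
structure Params where
  ε : ℝ
  α : ℝ
  β : ℝ
  a₁ : ℝ
  a₂ : ℝ
  T : ℝ
  L : ℕ

def nuMatrix (K : Consts) (p : Params) : Matrix (Fin 2) (Fin 2) ℝ :=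
  !![K.μ / K.N, -(K.θ / √K.N); -(K.θ / √K.N), p.α * K.lam2 / p.ε - K.θ]

theorem nuMatrix_isHermitian (K : Consts) (p : Params) : (nuMatrix K p).IsHermitian := by
  ext i j
  fin_cases i <;> fin_cases j <;> simp [nuMatrix]

/-- `ν = 2 λ_min` of the above matrix. -/
def nu (K : Consts) (p : Params) : ℝ := 2 * sortedEig (nuMatrix_isHermitian K p) 0

/-- The convergence rate `γ = ε ν β / 4`. -/
def rate (K : Consts) (p : Params) : ℝ := p.ε * nu K p * p.β / 4

def rho (K : Consts) (p : Params) : ℝ :=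
  (K.θ * p.ε / (p.α * K.lamN) + 1) *
    (8 * p.α * K.lamN / (nu K p ^ 2 * p.β * p.ε * √(1 - p.β)))

/-- The scaling function `s(k) = s(0) e^{-γ k T}`. -/
def scale (K : Consts) (p : Params) (k : ℕ) : ℝ :=
  p.ε * nu K p * K.M₀ / (p.α * K.lamN) * √(1 - p.β) *
    Real.exp (-rate K p * p.T - p.α * K.lamN * p.T) * Real.exp (-rate K p * k * p.T)

/-- The sampling condition `(e^{α λ_N T} - 1)(e^{γ T} - 1) ρ ε⁻¹ ≤ a₁`. -/
def SamplingCondition (K : Consts) (p : Params) : Prop :=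
  (Real.exp (p.α * K.lamN * p.T) - 1) * (Real.exp (rate K p * p.T) - 1) * rho K p * p.ε⁻¹ ≤ p.a₁

/-- The design rules for the parameters. -/
structure Admissible (K : Consts) (p : Params) : Prop where
  eps_pos : 0 < p.ε
  T_pos : 0 < p.T
  alpha_gt : p.ε / K.lam2 * (K.θ ^ 2 / K.μ + K.θ) < p.α
  beta_mem : p.β ∈ Ioo (0 : ℝ) 1
  a₁_mem : p.a₁ ∈ Ioo (0 : ℝ) 1
  a₂_mem : p.a₂ ∈ Ioo (0 : ℝ) (1 - p.a₁)
  sampling : SamplingCondition K p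
  L_pos : 0 < p.L
  L_ge_init : K.M₀ / scale K p 0 ≤ p.L
  L_ge : ⌈√((K.N : ℝ) * K.n) * Real.exp (p.ε * nu K p * p.β * p.T / 4 + p.α * K.lamN * p.T) /
      (2 * p.a₂) - 1 / 2⌉ ≤ (p.L : ℤ)

/-! ### The quantized dynamics -/

/-- The decoded value `x̂^j(kT)` along `x : ℝ → Fin N → Profile n`, where `x t j` is the vector of
player `j`'s estimates at time `t`. -/
def hat (K : Consts) (p : Params) (x : ℝ → Fin N → Profile n) (j : Fin N) (k : ℕ) : Profile n :=
  decoded p.L (scale K p) (fun l => x (l * p.T) j) k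

/-- `x` solves, for `t ≥ 0`,
`ẋ^i = α ∑_j a_{ij} (x̂^j(t) - x̂^i(t)) - R_i ∇_i J_i(x^i)`, where `x̂^j(t) = x̂^j(kT)` for
`kT ≤ t < (k+1)T` and `R_i` embeds `ε` times a vector of `ℝ^{n_i}` as the `i`-th block of `ℝ^n`.
Trajectories are continuous; at a sampling instant the derivative is the right derivative. -/
structure IsTrajectory (J : Fin N → Profile n → ℝ) (G : WGraph N) (K : Consts) (p : Params)
    (x : ℝ → Fin N → Profile n) : Prop where
  continuousOn : ∀ i, ContinuousOn (fun t => x t i) (Ici 0)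
  ode : ∀ i (k : ℕ), ∀ t ∈ Ico (k * p.T) ((k + 1) * p.T),
    HasDerivWithinAt (fun τ => x τ i)
      (p.α • ∑ j, G.a i j • (hat K p x j k - hat K p x i k)
        - (WithLp.toLp 2 (Pi.single i (p.ε • ownGrad J i (x t i))) : Profile n))
      (Ico (k * p.T) ((k + 1) * p.T)) t

/-- The dynamics converge exponentially to `xs`, at rate `γ`, from every initial state whose
entries are bounded by `M`: trajectories exist, and all of them converge. -/
def ExpConverges (J : Fin N → Profile n → ℝ) (G : WGraph N) (K : Consts) (p : Params) (M : ℝ)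
    (xs : Profile n) : Prop :=
  0 < rate K p ∧ ∃ C : ℝ, ∀ x₀ : Fin N → Profile n, (∀ i, SupBound M (x₀ i)) →
    (∃ x, IsTrajectory J G K p x ∧ x 0 = x₀) ∧
    ∀ x, IsTrajectory J G K p x → x 0 = x₀ →
      ∀ i t, 0 ≤ t → ‖x t i - xs‖ ≤ C * Real.exp (-rate K p * t)

/-! ### Bandwidth -/

/-- The bandwidth in bits per second when `r j i k` bits are sent over the edge `(j, i)` at the
instant `τ j i k`: the maximum over the edges of
`lim_{t → ∞} sup_{t' ≥ t} (1 / t') ∑_{τ_k ≤ t'} r(k)`. -/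
def bandwidth (G : WGraph N) (τ r : Fin N → Fin N → ℕ → ℝ) : EReal :=
  ⨆ (j : Fin N) (i : Fin N) (_ : G.graph.Adj j i),
    limsup (fun t' : ℝ => (((1 / t') * ∑ᶠ (k : ℕ) (_ : τ j i k ≤ t'), r j i k : ℝ) : EReal)) atTop

/-- Bits per sample: a message has `n` coordinates with `2L + 1` levels each. -/
def bitsPerSample (K : Consts) (L : ℕ) : ℝ := K.n * Real.logb 2 (2 * L + 1)

/-- The bandwidth used by the algorithm: one message per edge at each instant `kT`. -/
def algBandwidth (G : WGraph N) (K : Consts) (p : Params) : EReal :=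
  bandwidth G (fun _ _ k => k * p.T) (fun _ _ _ => bitsPerSample K p.L)

end

end QNash

/-!
Nash equilibria are the zeros of the strongly monotone Lipschitz game map, so there is exactly one.
Without quantization the stacked estimates approach consensus on it at the rate `ε ν / 2`: split
the state into its average and its disagreement, and use strong monotonicity on the former and the
spectral gap `λ_2` on the latter. A hold error `e` perturbs this decay by at most `α λ_N ‖e‖`, so as
long as `‖e‖` is at most a fixed fraction (`staleError`) of the distance bound `A e^{-γ t}`, the
distance obeys that bound. At a sampling instant an unsaturated quantizer brings the hold error down
to the strictly smaller fraction `freshError`. Within a period the state moves by `O((ε + α) T)`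
times the bound, which for small gains fills less than the gap between the two fractions, and the
scaling sequence decays at the same rate as the bound, so the quantizer never saturates. Multiplying
`ε` and `α` by a common small factor changes neither `ν` nor the fractions, hence one number of
levels serves every sampling period, and the bandwidth `n log₂ (2 L + 1) / T` is tuned through `T`.
-/

namespace QNash

section Eigenbasis

variable {ι E : Type*} [Fintype ι] [NormedAddCommGroup E] [InnerProductSpace ℝ E]
  {T : E →ₗ[ℝ] E} {b : OrthonormalBasis ι ℝ E} {ev : ι → ℝ}

theorem inner_eigenbasis_apply (hT : T.IsSymmetric) (hb : ∀ k, T (b k) = ev k • b k)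
    (k : ι) (v : E) : inner ℝ (b k) (T v) = ev k * inner ℝ (b k) v := by
  rw [← hT (b k) v, hb, real_inner_smul_left]

theorem inner_apply_eq_sum_eigenbasis (hT : T.IsSymmetric) (hb : ∀ k, T (b k) = ev k • b k)
    (v : E) : inner ℝ v (T v) = ∑ k, ev k * inner ℝ (b k) v ^ 2 := by
  rw [← b.sum_inner_mul_inner]
  refine Finset.sum_congr rfl fun k _ => ?_
  rw [inner_eigenbasis_apply hT hb, real_inner_comm]
  ring

theorem norm_sq_apply_eq_sum_eigenbasis (hT : T.IsSymmetric) (hb : ∀ k, T (b k) = ev k • b k)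
    (v : E) : ‖T v‖ ^ 2 = ∑ k, ev k ^ 2 * inner ℝ (b k) v ^ 2 := by
  simp_rw [← b.sum_sq_inner_right (T v), inner_eigenbasis_apply hT hb, mul_pow]

end Eigenbasis

section SortedEig

variable {m : ℕ} {A : Matrix (Fin m) (Fin m) ℝ}

theorem sortedEig_mono (hA : A.IsHermitian) : Monotone (sortedEig hA) :=
  fun _ _ hij => hA.eigenvalues₀_antitone (Fin.rev_le_rev.2 hij)

theorem exists_sorted_eigenbasis (hA : A.IsHermitian) :
    ∃ b : OrthonormalBasis (Fin m) ℝ (EuclideanSpace ℝ (Fin m)),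
      ∀ k, Matrix.toEuclideanLin A (b k) = sortedEig hA k • b k := by
  have hs := Matrix.isSymmetric_toEuclideanLin_iff.mpr hA
  refine ⟨(hs.eigenvectorBasis finrank_euclideanSpace).reindex
    ((finCongr (Fintype.card_fin m)).trans Fin.revPerm), fun k => ?_⟩
  rw [OrthonormalBasis.reindex_apply, hs.apply_eigenvectorBasis]
  rfl

theorem exists_unit_inner_apply_eq_sortedEig (hA : A.IsHermitian) (k : Fin m) :
    ∃ v : EuclideanSpace ℝ (Fin m), ‖v‖ = 1 ∧
      inner ℝ v (Matrix.toEuclideanLin A v) = sortedEig hA k := by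
  obtain ⟨b, hb⟩ := exists_sorted_eigenbasis hA
  refine ⟨b k, b.norm_eq_one k, ?_⟩
  rw [hb, real_inner_smul_right, real_inner_self_eq_norm_sq, b.norm_eq_one, one_pow, mul_one]

theorem sortedEig_mul_norm_sq_le_inner (hA : A.IsHermitian) {k : Fin m} (hk : ∀ j, k ≤ j)
    (v : EuclideanSpace ℝ (Fin m)) :
    sortedEig hA k * ‖v‖ ^ 2 ≤ inner ℝ v (Matrix.toEuclideanLin A v) := by
  obtain ⟨b, hb⟩ := exists_sorted_eigenbasis hA
  rw [inner_apply_eq_sum_eigenbasis (Matrix.isSymmetric_toEuclideanLin_iff.mpr hA) hb,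
    ← b.sum_sq_inner_right, Finset.mul_sum]
  gcongr with j
  exact sortedEig_mono hA (hk j)

theorem norm_toEuclideanLin_le_sortedEig_mul (hA : A.IsHermitian)
    (hnonneg : ∀ j, 0 ≤ sortedEig hA j) {k : Fin m} (hk : ∀ j, j ≤ k)
    (v : EuclideanSpace ℝ (Fin m)) :
    ‖Matrix.toEuclideanLin A v‖ ≤ sortedEig hA k * ‖v‖ := by
  obtain ⟨b, hb⟩ := exists_sorted_eigenbasis hA
  refine le_of_sq_le_sq ?_ (mul_nonneg (hnonneg k) (norm_nonneg v))
  rw [norm_sq_apply_eq_sum_eigenbasis (Matrix.isSymmetric_toEuclideanLin_iff.mpr hA) hb, mul_pow,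
    ← b.sum_sq_inner_right v, Finset.mul_sum]
  gcongr with j
  · exact hnonneg j
  · exact sortedEig_mono hA (hk j)

end SortedEig

namespace WGraph

variable {N : ℕ} {G : WGraph N} {u v : EuclideanSpace ℝ (Fin N)}

theorem a_self (G : WGraph N) (i : Fin N) : G.a i i = 0 := G.zero i i G.graph.irrefl

theorem a_nonneg (G : WGraph N) (i j : Fin N) : 0 ≤ G.a i j := by
  by_cases h : G.graph.Adj i j
  · exact (G.pos i j h).le
  · exact (G.zero i j h).ge

theorem lap_apply_apply (G : WGraph N) (v : EuclideanSpace ℝ (Fin N)) (i : Fin N) :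
    Matrix.toEuclideanLin G.lap v i = ∑ j, G.a i j * (v i - v j) := by
  have entry (j : Fin N) : G.lap i j * v j
      = (if i = j then (∑ k, G.a i k) * v i else 0) - G.a i j * v j := by
    by_cases h : i = j
    · subst h
      simp [lap, G.a_self]
    · simp [lap, h]
  calc Matrix.toEuclideanLin G.lap v i = ∑ j, G.lap i j * v j := by
        simp [Matrix.toLpLin_apply, Matrix.mulVec, dotProduct]
    _ = (∑ k, G.a i k) * v i - ∑ j, G.a i j * v j := by
        simp [entry, Finset.sum_sub_distrib]
    _ = ∑ j, G.a i j * (v i - v j) := by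
        simp_rw [mul_sub, Finset.sum_sub_distrib, Finset.sum_mul]

theorem inner_lap_apply_eq_sum (G : WGraph N) (v : EuclideanSpace ℝ (Fin N)) :
    inner ℝ v (Matrix.toEuclideanLin G.lap v)
      = 1 / 2 * ∑ i, ∑ j, G.a i j * (v i - v j) ^ 2 := by
  have expand : inner ℝ v (Matrix.toEuclideanLin G.lap v)
      = ∑ i, ∑ j, G.a i j * (v i * (v i - v j)) := by
    simp_rw [PiLp.inner_apply, lap_apply_apply, RCLike.inner_apply, conj_trivial, Finset.sum_mul]
    exact Finset.sum_congr rfl fun i _ => Finset.sum_congr rfl fun j _ => by ring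
  have swap : ∑ i, ∑ j, G.a i j * (v i * (v i - v j))
      = ∑ i, ∑ j, G.a i j * (v j * (v j - v i)) := by
    rw [Finset.sum_comm]
    exact Finset.sum_congr rfl fun i _ => Finset.sum_congr rfl fun j _ => by rw [G.symm]
  have split : ∑ i, ∑ j, G.a i j * (v i - v j) ^ 2
      = ∑ i, ∑ j, G.a i j * (v i * (v i - v j)) + ∑ i, ∑ j, G.a i j * (v j * (v j - v i)) := by
    simp_rw [← Finset.sum_add_distrib]
    exact Finset.sum_congr rfl fun i _ => Finset.sum_congr rfl fun j _ => by ring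
  rw [expand, split, ← swap]
  ring

theorem inner_lap_apply_nonneg (G : WGraph N) (v : EuclideanSpace ℝ (Fin N)) :
    0 ≤ inner ℝ v (Matrix.toEuclideanLin G.lap v) := by
  rw [inner_lap_apply_eq_sum]
  exact mul_nonneg (by norm_num) (Finset.sum_nonneg fun i _ => Finset.sum_nonneg fun j _ =>
    mul_nonneg (G.a_nonneg i j) (sq_nonneg _))

theorem sortedEig_lap_nonneg (G : WGraph N) (k : Fin N) :
    0 ≤ sortedEig G.lap_isHermitian k := by
  obtain ⟨v, -, hv⟩ := exists_unit_inner_apply_eq_sortedEig G.lap_isHermitian k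
  exact hv ▸ G.inner_lap_apply_nonneg v

theorem sortedEig_lap_eq_zero (G : WGraph N) {k : Fin N} (hk : ∀ j, k ≤ j) :
    sortedEig G.lap_isHermitian k = 0 := by
  set one : EuclideanSpace ℝ (Fin N) := WithLp.toLp 2 fun _ => 1
  have hrayleigh := sortedEig_mul_norm_sq_le_inner G.lap_isHermitian hk one
  have hpos : 0 < ‖one‖ ^ 2 := by
    rw [EuclideanSpace.real_norm_sq_eq]
    simpa [one] using k.pos
  simp only [inner_lap_apply_eq_sum, one, sub_self, ne_eq, OfNat.ofNat_ne_zero,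
    not_false_eq_true, zero_pow, mul_zero, Finset.sum_const_zero] at hrayleigh
  exact le_antisymm (nonpos_of_mul_nonpos_left hrayleigh hpos) (G.sortedEig_lap_nonneg k)

theorem apply_eq_apply_of_lap_apply_eq_zero (hG : G.graph.Preconnected)
    (hv : Matrix.toEuclideanLin G.lap v = 0) (i j : Fin N) : v i = v j := by
  have term_nonneg (i j : Fin N) : 0 ≤ G.a i j * (v i - v j) ^ 2 :=
    mul_nonneg (G.a_nonneg i j) (sq_nonneg _)
  have sum_eq_zero : ∑ i, ∑ j, G.a i j * (v i - v j) ^ 2 = 0 := by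
    have := G.inner_lap_apply_eq_sum v
    rw [hv, inner_zero_right] at this
    linarith
  have eq_of_adj (i j : Fin N) (hij : G.graph.Adj i j) : v i = v j := by
    have row := (Finset.sum_eq_zero_iff_of_nonneg
      (fun i _ => Finset.sum_nonneg fun j _ => term_nonneg i j)).1 sum_eq_zero i (Finset.mem_univ i)
    have term := (Finset.sum_eq_zero_iff_of_nonneg (fun j _ => term_nonneg i j)).1 row j
      (Finset.mem_univ j)
    simpa [(G.pos i j hij).ne', sub_eq_zero] using term
  obtain ⟨w⟩ := hG i j
  induction w with
  | nil => rfl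
  | cons hij _ ih => exact (eq_of_adj _ _ hij).trans ih

theorem inner_eq_zero_of_lap_apply_eq_zero (hG : G.graph.Preconnected)
    (hu : Matrix.toEuclideanLin G.lap u = 0) (hv : ∑ i, v i = 0) : inner ℝ u v = 0 := by
  rcases isEmpty_or_nonempty (Fin N) with _ | ⟨⟨i⟩⟩
  · simp [PiLp.inner_apply]
  · simp_rw [PiLp.inner_apply, apply_eq_apply_of_lap_apply_eq_zero hG hu _ i, RCLike.inner_apply,
      ← Finset.sum_mul, hv, zero_mul]

theorem sortedEig_lap_pos (hG : G.graph.Preconnected) {k : Fin N} (hk : (k : ℕ) ≠ 0) :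
    0 < sortedEig G.lap_isHermitian k := by
  obtain ⟨b, hb⟩ := exists_sorted_eigenbasis G.lap_isHermitian
  refine (G.sortedEig_lap_nonneg k).lt_of_ne' fun hzero => ?_
  let first : Fin N := ⟨0, k.pos⟩
  have ker_first : Matrix.toEuclideanLin G.lap (b first) = 0 := by
    rw [hb, G.sortedEig_lap_eq_zero fun j => Nat.zero_le j, zero_smul]
  have ker_k : Matrix.toEuclideanLin G.lap (b k) = 0 := by rw [hb, hzero, zero_smul]
  have const_first (i : Fin N) : b first i = b first k :=
    apply_eq_apply_of_lap_apply_eq_zero hG ker_first i k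
  have first_ne_zero : b first k ≠ 0 := fun h =>
    b.orthonormal.ne_zero first (by ext i; simp [const_first i, h])
  have orth : inner ℝ (b first) (b k) = 0 :=
    b.orthonormal.inner_eq_zero fun h => hk (congrArg Fin.val h).symm
  simp_rw [PiLp.inner_apply, RCLike.inner_apply, conj_trivial, const_first,
    ← Finset.sum_mul] at orth
  have sum_zero := (mul_eq_zero.1 orth).resolve_right first_ne_zero
  exact b.orthonormal.ne_zero k
    (inner_self_eq_zero.1 (inner_eq_zero_of_lap_apply_eq_zero hG ker_k sum_zero))

theorem sortedEig_mul_norm_sq_le_inner_lap (hG : G.graph.Preconnected) {k : Fin N}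
    (hk : (k : ℕ) ≤ 1) (hv : ∑ i, v i = 0) :
    sortedEig G.lap_isHermitian k * ‖v‖ ^ 2 ≤ inner ℝ v (Matrix.toEuclideanLin G.lap v) := by
  obtain ⟨b, hb⟩ := exists_sorted_eigenbasis G.lap_isHermitian
  rw [inner_apply_eq_sum_eigenbasis
      (Matrix.isSymmetric_toEuclideanLin_iff.mpr G.lap_isHermitian) hb,
    ← b.sum_sq_inner_right, Finset.mul_sum]
  refine Finset.sum_le_sum fun j _ => ?_
  by_cases hj : (j : ℕ) = 0
  · have ker_j : Matrix.toEuclideanLin G.lap (b j) = 0 := by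
      rw [hb, G.sortedEig_lap_eq_zero fun l => Fin.le_def.2 (hj ▸ Nat.zero_le l), zero_smul]
    simp [inner_eq_zero_of_lap_apply_eq_zero hG ker_j hv]
  · gcongr
    exact sortedEig_mono _ (Fin.le_def.2 (by omega))

end WGraph

section StronglyMonotone

variable {E : Type*} [NormedAddCommGroup E] [InnerProductSpace ℝ E] {f : E → E} {μ θ τ : ℝ}

theorem norm_sub_smul_sub_sq_le {x y : E} (hmono : μ * ‖x - y‖ ^ 2 ≤ inner ℝ (f x - f y) (x - y))
    (hlip : ‖f x - f y‖ ≤ θ * ‖x - y‖) (hτ : 0 ≤ τ) :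
    ‖(x - τ • f x) - (y - τ • f y)‖ ^ 2 ≤ (1 - 2 * τ * μ + τ ^ 2 * θ ^ 2) * ‖x - y‖ ^ 2 := by
  calc ‖(x - τ • f x) - (y - τ • f y)‖ ^ 2
      = ‖(x - y) - τ • (f x - f y)‖ ^ 2 := by rw [smul_sub]; congr 2; abel
    _ = ‖x - y‖ ^ 2 - 2 * τ * inner ℝ (f x - f y) (x - y) + τ ^ 2 * ‖f x - f y‖ ^ 2 := by
        rw [norm_sub_sq_real, real_inner_smul_right, real_inner_comm, norm_smul, mul_pow,
          Real.norm_eq_abs, sq_abs]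
        ring
    _ ≤ ‖x - y‖ ^ 2 - 2 * τ * (μ * ‖x - y‖ ^ 2) + τ ^ 2 * (θ * ‖x - y‖) ^ 2 := by gcongr
    _ = _ := by ring

theorem exists_eq_zero_of_stronglyMonotone [CompleteSpace E] (hμ : 0 < μ)
    (hmono : ∀ x y, μ * ‖x - y‖ ^ 2 ≤ inner ℝ (f x - f y) (x - y))
    (hlip : ∀ x y, ‖f x - f y‖ ≤ θ * ‖x - y‖) : ∃ x, f x = 0 := by
  set τ := μ / (θ ^ 2 + 1) with hτ
  have hτ_pos : 0 < τ := by positivity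
  set q := √(1 - 2 * τ * μ + τ ^ 2 * θ ^ 2)
  have hq : q < 1 := by
    rw [Real.sqrt_lt' one_pos]
    have : τ * (θ ^ 2 + 1) = μ := by rw [hτ]; field_simp
    nlinarith [mul_pos hτ_pos hτ_pos, mul_pos hτ_pos hμ]
  have hcontr : ContractingWith q.toNNReal fun x => x - τ • f x := by
    refine ⟨by simpa using hq, LipschitzWith.of_dist_le_mul fun x y => ?_⟩
    rw [Real.coe_toNNReal _ (Real.sqrt_nonneg _), dist_eq_norm, dist_eq_norm]
    refine (Real.le_sqrt_of_sq_le
      (norm_sub_smul_sub_sq_le (hmono x y) (hlip x y) hτ_pos.le)).trans_eq ?_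
    rw [Real.sqrt_mul' _ (sq_nonneg _), Real.sqrt_sq (norm_nonneg _)]
  have hfix := hcontr.fixedPoint_isFixedPt
  rw [Function.IsFixedPt, sub_eq_self, smul_eq_zero] at hfix
  exact ⟨_, hfix.resolve_left hτ_pos.ne'⟩

theorem eq_of_stronglyMonotone_of_eq {x y : E} (hμ : 0 < μ)
    (hmono : μ * ‖x - y‖ ^ 2 ≤ inner ℝ (f x - f y) (x - y)) (hxy : f x = f y) : x = y := by
  rw [hxy, sub_self, inner_zero_left] at hmono
  have : ‖x - y‖ ^ 2 = 0 := le_antisymm (nonpos_of_mul_nonpos_right hmono hμ) (sq_nonneg _)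
  exact sub_eq_zero.1 (norm_eq_zero.1 (pow_eq_zero_iff two_ne_zero |>.1 this))

end StronglyMonotone

section Game

theorem le_of_convexOn_of_fderiv_eq_zero {E : Type*} [NormedAddCommGroup E] [NormedSpace ℝ E]
    {f : E → ℝ} {x : E} (hf : ConvexOn ℝ univ f) (hd : DifferentiableAt ℝ f x)
    (hcrit : fderiv ℝ f x = 0) (y : E) : f x ≤ f y := by
  let line : ℝ →ᵃ[ℝ] E := AffineMap.lineMap x y
  have hconv : ConvexOn ℝ univ (f ∘ line) := by simpa using hf.comp_affineMap line
  have hderiv : HasDerivAt (f ∘ line) 0 0 := by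
    have : HasFDerivAt f (0 : E →L[ℝ] ℝ) (line 0) := by
      rw [AffineMap.lineMap_apply_zero, ← hcrit]
      exact hd.hasFDerivAt
    simpa using this.comp_hasDerivAt (0 : ℝ) AffineMap.hasDerivAt_lineMap
  have := hconv.le_slope_of_hasDerivAt (mem_univ 0) (mem_univ 1) one_pos hderiv
  simpa [slope_def_field, line] using this

variable {N : ℕ} {n : Fin N → ℕ} {J : Fin N → Profile n → ℝ} {μ : ℝ} {θown θoth : Fin N → ℝ}

theorem replace_apply_self (x : Profile n) (i : Fin N) (y : Action n i) : replace x i y i = y := by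
  simp [replace]

theorem replace_apply_of_ne (x : Profile n) {i j : Fin N} (h : j ≠ i) (y : Action n i) :
    replace x i y j = x j := by
  simp [replace, h]

theorem replace_self (x : Profile n) (i : Fin N) : replace x i (x i) = x := by
  simp [replace]

theorem gameMap_eq_zero_iff {x : Profile n} : gameMap J x = 0 ↔ ∀ i, ownGrad J i x = 0 :=
  ⟨fun h i => congrArg (fun z : Profile n => z i) h, fun h => by ext1 i; exact h i⟩

theorem ownGrad_eq_zero_iff {i : Fin N} {x : Profile n} :
    ownGrad J i x = 0 ↔ fderiv ℝ (fun y => J i (replace x i y)) (x i) = 0 := by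
  simp [ownGrad, gradient]

theorem isNash_iff_gameMap_eq_zero
    (hconv : ∀ i x, ConvexOn ℝ univ fun y => J i (replace x i y))
    (hdiff : ∀ i x, Differentiable ℝ fun y => J i (replace x i y)) {x : Profile n} :
    IsNash J x ↔ gameMap J x = 0 := by
  rw [gameMap_eq_zero_iff]
  refine forall_congr' fun i => ?_
  rw [ownGrad_eq_zero_iff]
  constructor
  · refine fun h => IsLocalMin.fderiv_eq_zero (Eventually.of_forall fun y => ?_)
    simpa only [replace_self] using h y
  · intro h y
    simpa only [replace_self] using le_of_convexOn_of_fderiv_eq_zero (hconv i x) (hdiff i x _) h y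

theorem norm_sub_sq_eq_add_norm_replace_sub_sq (x y : Profile n) (i : Fin N) :
    ‖x - y‖ ^ 2 = ‖x i - y i‖ ^ 2 + ‖replace x i (y i) - y‖ ^ 2 := by
  rw [PiLp.norm_sq_eq_of_L2 _ (x - y), PiLp.norm_sq_eq_of_L2 _ (replace x i (y i) - y),
    ← Finset.add_sum_erase _ _ (Finset.mem_univ i),
    ← Finset.add_sum_erase _ (fun j => ‖(replace x i (y i) - y) j‖ ^ 2) (Finset.mem_univ i)]
  have hother : ∑ j ∈ Finset.univ.erase i, ‖(replace x i (y i) - y) j‖ ^ 2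
      = ∑ j ∈ Finset.univ.erase i, ‖(x - y) j‖ ^ 2 := by
    refine Finset.sum_congr rfl fun j hj => ?_
    rw [PiLp.sub_apply, PiLp.sub_apply, replace_apply_of_ne x (Finset.ne_of_mem_erase hj)]
  rw [hother, PiLp.sub_apply, PiLp.sub_apply, replace_apply_self]
  simp

theorem norm_ownGrad_sub_sq_le (hF : MapAssumption J μ θown θoth) (i : Fin N) (x y : Profile n) :
    ‖ownGrad J i x - ownGrad J i y‖ ^ 2 ≤ (θown i ^ 2 + θoth i ^ 2) * ‖x - y‖ ^ 2 := by
  set z := replace x i (y i) with hz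
  have hown : ‖ownGrad J i x - ownGrad J i z‖ ≤ θown i * ‖x i - y i‖ := by
    have := hF.lipschitz_own i x z fun j hj => (replace_apply_of_ne x hj _).symm
    rwa [hz, replace_apply_self] at this
  have hoth : ‖ownGrad J i z - ownGrad J i y‖ ≤ θoth i * ‖z - y‖ :=
    hF.lipschitz_oth i z y (replace_apply_self x i _)
  calc ‖ownGrad J i x - ownGrad J i y‖ ^ 2
      ≤ (θown i * ‖x i - y i‖ + θoth i * ‖z - y‖) ^ 2 := by
        gcongr
        exact (norm_sub_le_norm_sub_add_norm_sub _ (ownGrad J i z) _).trans (add_le_add hown hoth)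
    _ ≤ (θown i ^ 2 + θoth i ^ 2) * (‖x i - y i‖ ^ 2 + ‖z - y‖ ^ 2) := by
        nlinarith only [sq_nonneg (θown i * ‖z - y‖ - θoth i * ‖x i - y i‖)]
    _ = _ := by rw [norm_sub_sq_eq_add_norm_replace_sub_sq x y i]

theorem lipConst_nonneg (θown θoth : Fin N → ℝ) : 0 ≤ lipConst θown θoth := Real.sqrt_nonneg _

theorem lipConst_sq (θown θoth : Fin N → ℝ) :
    lipConst θown θoth ^ 2 = ∑ i, (θown i ^ 2 + θoth i ^ 2) :=
  Real.sq_sqrt (Finset.sum_nonneg fun _ _ => by positivity)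

theorem norm_gameMap_sub_le (hF : MapAssumption J μ θown θoth) (x y : Profile n) :
    ‖gameMap J x - gameMap J y‖ ≤ lipConst θown θoth * ‖x - y‖ := by
  refine le_of_sq_le_sq ?_ (mul_nonneg (lipConst_nonneg _ _) (norm_nonneg _))
  rw [mul_pow, lipConst_sq, PiLp.norm_sq_eq_of_L2, Finset.sum_mul]
  exact Finset.sum_le_sum fun i _ => norm_ownGrad_sub_sq_le hF i x y

theorem existsUnique_gameMap_eq_zero (hF : MapAssumption J μ θown θoth) :
    ∃! x, gameMap J x = 0 := by
  obtain ⟨x, hx⟩ := exists_eq_zero_of_stronglyMonotone hF.mu_pos hF.stronglyMonotone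
    (norm_gameMap_sub_le hF)
  exact ⟨x, hx, fun y hy =>
    eq_of_stronglyMonotone_of_eq hF.mu_pos (hF.stronglyMonotone y x) (hy.trans hx.symm)⟩

end Game

section State

variable {N : ℕ} {n : Fin N → ℕ} {J : Fin N → Profile n → ℝ} {μ : ℝ} {θown θoth : Fin N → ℝ}
  {G : WGraph N}

/-- The joint state `(𝒙¹, …, 𝒙ᴺ)` of the players' estimates, with the Euclidean norm. -/
abbrev State {N : ℕ} (n : Fin N → ℕ) : Type := PiLp 2 fun _ : Fin N => Profile n

/-- The state in which all the players' estimates agree. -/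
noncomputable def consensus : Profile n →ₗ[ℝ] State n where
  toFun x := WithLp.toLp 2 fun _ => x
  map_add' _ _ := rfl
  map_smul' _ _ := rfl

/-- The average of the players' estimates. -/
noncomputable def average (X : State n) : Profile n := (N : ℝ)⁻¹ • ∑ i, X i

/-- The profile made of each player's estimate of its own action. -/
noncomputable def diag : State n →ₗ[ℝ] Profile n where
  toFun X := WithLp.toLp 2 fun i => X i i
  map_add' _ _ := rfl
  map_smul' _ _ := rfl

/-- The adjoint of `diag`: the state whose `i`-th estimate has `i`-th block `u i` and all other
blocks zero. -/
noncomputable def embed : Profile n →ₗ[ℝ] State n where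
  toFun u := WithLp.toLp 2 fun i => WithLp.toLp 2 (Pi.single i (u i))
  map_add' u v := by
    ext1 i
    exact congrArg (WithLp.toLp 2) (Pi.single_add i (u i) (v i))
  map_smul' r u := by
    ext1 i
    exact congrArg (WithLp.toLp 2) (Pi.single_smul i r (u i))

/-- The augmented game mapping: each partial gradient is evaluated at the player's own estimate. -/
noncomputable def diagGrad (J : Fin N → Profile n → ℝ) (X : State n) : Profile n :=
  WithLp.toLp 2 fun i => ownGrad J i (X i)

/-- The Laplacian of the communication graph acting on states. -/
noncomputable def lapState (G : WGraph N) : State n →ₗ[ℝ] State n where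
  toFun X := WithLp.toLp 2 fun i => ∑ j, G.a i j • (X i - X j)
  map_add' X Y := by
    ext1 i
    simp only [PiLp.add_apply, ← Finset.sum_add_distrib, ← smul_add, add_sub_add_comm]
  map_smul' r X := by
    ext1 i
    simp only [PiLp.smul_apply, Finset.smul_sum, ← smul_sub, smul_comm r, RingHom.id_apply]

/-- The estimates of coordinate `c` of player `k`'s action, one for each player. -/
noncomputable def slice (X : State n) (k : Fin N) (c : Fin (n k)) : EuclideanSpace ℝ (Fin N) :=
  WithLp.toLp 2 fun i => X i k c

theorem consensus_apply (x : Profile n) (i : Fin N) : consensus x i = x := rfl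

theorem diag_apply (X : State n) (i : Fin N) : diag X i = X i i := rfl

theorem embed_apply (u : Profile n) (i : Fin N) :
    embed u i = WithLp.toLp 2 (Pi.single i (u i)) := rfl

theorem lapState_apply (G : WGraph N) (X : State n) (i : Fin N) :
    lapState G X i = ∑ j, G.a i j • (X i - X j) := rfl

theorem inner_eq_sum_inner_slice (X Y : State n) :
    inner ℝ X Y = ∑ k, ∑ c, inner ℝ (slice X k c) (slice Y k c) := by
  simp_rw [PiLp.inner_apply]
  rw [Finset.sum_comm]
  exact Finset.sum_congr rfl fun k _ => Finset.sum_comm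

theorem norm_sq_eq_sum_norm_slice_sq (X : State n) : ‖X‖ ^ 2 = ∑ k, ∑ c, ‖slice X k c‖ ^ 2 := by
  simp_rw [← real_inner_self_eq_norm_sq, inner_eq_sum_inner_slice]

theorem slice_lapState (G : WGraph N) (X : State n) (k : Fin N) (c : Fin (n k)) :
    slice (lapState G X) k c = Matrix.toEuclideanLin G.lap (slice X k c) := by
  ext i
  rw [G.lap_apply_apply]
  simp [slice, lapState_apply]

theorem norm_lapState_le (G : WGraph N) {k : Fin N} (hk : ∀ j, j ≤ k) (X : State n) :
    ‖lapState G X‖ ≤ sortedEig G.lap_isHermitian k * ‖X‖ := by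
  refine le_of_sq_le_sq ?_ (mul_nonneg (G.sortedEig_lap_nonneg _) (norm_nonneg _))
  simp_rw [mul_pow, norm_sq_eq_sum_norm_slice_sq, Finset.mul_sum, slice_lapState, ← mul_pow]
  gcongr
  exact norm_toEuclideanLin_le_sortedEig_mul _ G.sortedEig_lap_nonneg hk _

theorem sortedEig_mul_norm_sq_le_inner_lapState (hG : G.graph.Preconnected) {k : Fin N}
    (hk : (k : ℕ) ≤ 1) {X : State n} (hX : ∑ i, X i = 0) :
    sortedEig G.lap_isHermitian k * ‖X‖ ^ 2 ≤ inner ℝ X (lapState G X) := by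
  simp_rw [norm_sq_eq_sum_norm_slice_sq, inner_eq_sum_inner_slice, Finset.mul_sum, slice_lapState]
  gcongr with l _ c
  refine WGraph.sortedEig_mul_norm_sq_le_inner_lap hG hk ?_
  simpa [slice] using congrArg (fun x : Profile n => x l c) hX

theorem lapState_consensus (G : WGraph N) (x : Profile n) : lapState G (consensus x) = 0 := by
  ext1 i
  simp [lapState_apply, consensus_apply]

theorem sum_lapState (G : WGraph N) (X : State n) : ∑ i, lapState G X i = 0 := by
  have swap : ∑ i, ∑ j, G.a i j • (X i - X j) = ∑ i, ∑ j, G.a i j • (X j - X i) := by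
    rw [Finset.sum_comm]
    exact Finset.sum_congr rfl fun i _ => Finset.sum_congr rfl fun j _ => by rw [G.symm]
  have neg : ∑ i, ∑ j, G.a i j • (X j - X i) = -∑ i, ∑ j, G.a i j • (X i - X j) := by
    simp_rw [← Finset.sum_neg_distrib, ← smul_neg, neg_sub]
  have : IsAddTorsionFree (Profile n) := .of_isTorsionFree ℝ _
  exact self_eq_neg.1 (swap.trans neg)

theorem diag_consensus (x : Profile n) : diag (consensus x) = x := rfl

theorem norm_diag_le (X : State n) : ‖diag X‖ ≤ ‖X‖ := by
  refine le_of_sq_le_sq ?_ (norm_nonneg _)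
  rw [PiLp.norm_sq_eq_of_L2, PiLp.norm_sq_eq_of_L2]
  exact Finset.sum_le_sum fun i _ =>
    pow_le_pow_left₀ (norm_nonneg _) (PiLp.norm_apply_le (X i) i) 2

theorem norm_embed (u : Profile n) : ‖embed u‖ = ‖u‖ := by
  refine (pow_left_inj₀ (norm_nonneg _) (norm_nonneg _) two_ne_zero).1 ?_
  rw [PiLp.norm_sq_eq_of_L2, PiLp.norm_sq_eq_of_L2]
  exact Finset.sum_congr rfl fun i _ => by simp [embed_apply]

theorem inner_embed (X : State n) (u : Profile n) : inner ℝ X (embed u) = inner ℝ (diag X) u := by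
  rw [PiLp.inner_apply, PiLp.inner_apply]
  refine Finset.sum_congr rfl fun i _ => ?_
  rw [PiLp.inner_apply, Finset.sum_eq_single_of_mem i (Finset.mem_univ i)
    fun j _ hj => by simp [embed_apply, hj]]
  simp [embed_apply, diag_apply]

theorem norm_consensus_sq (x : Profile n) : ‖consensus x‖ ^ 2 = N * ‖x‖ ^ 2 := by
  rw [PiLp.norm_sq_eq_of_L2]
  simp [consensus_apply]

theorem inner_consensus (x : Profile n) (X : State n) :
    inner ℝ (consensus x) X = inner ℝ x (∑ i, X i) := by
  rw [PiLp.inner_apply, inner_sum]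
  rfl

theorem sum_sub_consensus_average (X : State n) : ∑ i, (X - consensus (average X)) i = 0 := by
  rcases N.eq_zero_or_pos with rfl | hN
  · simp
  · have hN0 : (N : ℝ) ≠ 0 := by positivity
    simp only [PiLp.sub_apply, Finset.sum_sub_distrib, consensus_apply]
    simp [average, ← Nat.cast_smul_eq_nsmul ℝ, smul_smul, hN0]

theorem sub_consensus_eq_consensus_add (X : State n) (x : Profile n) :
    X - consensus x = consensus (average X - x) + (X - consensus (average X)) := by
  rw [map_sub]
  abel

theorem norm_sub_consensus_sq (X : State n) (x : Profile n) :
    ‖X - consensus x‖ ^ 2 = N * ‖average X - x‖ ^ 2 + ‖X - consensus (average X)‖ ^ 2 := by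
  rw [sub_consensus_eq_consensus_add, norm_add_sq_real, inner_consensus, sum_sub_consensus_average,
    inner_zero_right, norm_consensus_sq]
  ring

theorem sortedEig_mul_norm_sub_average_sq_le (hG : G.graph.Preconnected) {k : Fin N}
    (hk : (k : ℕ) ≤ 1) (X : State n) (x : Profile n) :
    sortedEig G.lap_isHermitian k * ‖X - consensus (average X)‖ ^ 2
      ≤ inner ℝ (X - consensus x) (lapState G X) := by
  have hlap : lapState G X = lapState G (X - consensus (average X)) := by
    rw [map_sub, lapState_consensus, sub_zero]
  rw [sub_consensus_eq_consensus_add X x, inner_add_left, inner_consensus, sum_lapState,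
    inner_zero_right, zero_add, hlap]
  exact sortedEig_mul_norm_sq_le_inner_lapState hG hk (sum_sub_consensus_average X)

theorem diagGrad_consensus (x : Profile n) : diagGrad J (consensus x) = gameMap J x := rfl

theorem norm_diagGrad_sub_le (hF : MapAssumption J μ θown θoth) (X Y : State n) :
    ‖diagGrad J X - diagGrad J Y‖ ≤ lipConst θown θoth * ‖X - Y‖ := by
  refine le_of_sq_le_sq ?_ (mul_nonneg (lipConst_nonneg _ _) (norm_nonneg _))
  rw [mul_pow, lipConst_sq, PiLp.norm_sq_eq_of_L2, Finset.sum_mul]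
  refine Finset.sum_le_sum fun i _ => (norm_ownGrad_sub_sq_le hF i (X i) (Y i)).trans ?_
  gcongr
  exact PiLp.norm_apply_le (X - Y) i

theorem le_inner_embed_diagGrad (hF : MapAssumption J μ θown θoth) (X : State n)
    {xs : Profile n} (hxs : gameMap J xs = 0) (y : Profile n) :
    μ * ‖y - xs‖ ^ 2 - 2 * lipConst θown θoth * ‖y - xs‖ * ‖X - consensus y‖
        - lipConst θown θoth * ‖X - consensus y‖ ^ 2
      ≤ inner ℝ (X - consensus xs) (embed (diagGrad J X)) := by
  set θ := lipConst θown θoth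
  have : 0 ≤ θ := lipConst_nonneg _ _
  set D := diagGrad J X - gameMap J y
  set w := diag X - y
  have hD : ‖D‖ ≤ θ * ‖X - consensus y‖ := norm_diagGrad_sub_le hF X (consensus y)
  have hw : ‖w‖ ≤ ‖X - consensus y‖ := norm_diag_le (X - consensus y)
  have hFy : ‖gameMap J y‖ ≤ θ * ‖y - xs‖ := by
    simpa only [hxs, sub_zero] using norm_gameMap_sub_le hF y xs
  have hmono : μ * ‖y - xs‖ ^ 2 ≤ inner ℝ (y - xs) (gameMap J y) := by
    simpa only [hxs, sub_zero, real_inner_comm] using hF.stronglyMonotone y xs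
  have hsplit : inner ℝ (X - consensus xs) (embed (diagGrad J X))
      = inner ℝ (y - xs) (gameMap J y) + inner ℝ (y - xs) D + inner ℝ w D
        + inner ℝ w (gameMap J y) := by
    have hX : diag X - xs = (y - xs) + w := by simp only [w]; abel
    have hgrad : diagGrad J X = D + gameMap J y := by simp only [D]; abel
    rw [inner_embed, map_sub, diag_consensus, hX, hgrad, inner_add_left, inner_add_right,
      inner_add_right]
    ring
  have hyD : -(‖y - xs‖ * (θ * ‖X - consensus y‖)) ≤ inner ℝ (y - xs) D :=
    (neg_le_neg (by gcongr)).trans (neg_le_of_abs_le (abs_real_inner_le_norm _ _))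
  have hwD : -(‖X - consensus y‖ * (θ * ‖X - consensus y‖)) ≤ inner ℝ w D :=
    (neg_le_neg (by gcongr)).trans (neg_le_of_abs_le (abs_real_inner_le_norm _ _))
  have hwF : -(‖X - consensus y‖ * (θ * ‖y - xs‖)) ≤ inner ℝ w (gameMap J y) :=
    (neg_le_neg (by gcongr)).trans (neg_le_of_abs_le (abs_real_inner_le_norm _ _))
  rw [hsplit]
  linarith

end State

section Nu

variable {K : Consts} {p : Params}

theorem inner_nuMatrix (v : EuclideanSpace ℝ (Fin 2)) :
    inner ℝ v (Matrix.toEuclideanLin (nuMatrix K p) v)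
      = K.μ / K.N * v 0 ^ 2 - 2 * (K.θ / √K.N) * (v 0 * v 1)
        + (p.α * K.lam2 / p.ε - K.θ) * v 1 ^ 2 := by
  simp [PiLp.inner_apply, Fin.sum_univ_two, nuMatrix, Matrix.toLpLin_apply,
    dotProduct]
  ring

theorem half_nu_mul_le (hN : 0 < K.N) (a b : ℝ) :
    nu K p / 2 * (K.N * a ^ 2 + b ^ 2)
      ≤ K.μ * a ^ 2 - 2 * K.θ * a * b + (p.α * K.lam2 / p.ε - K.θ) * b ^ 2 := by
  have hN' : (0 : ℝ) < K.N := by exact_mod_cast hN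
  have hsqrt : √(K.N : ℝ) ≠ 0 := (Real.sqrt_pos.2 hN').ne'
  have h := sortedEig_mul_norm_sq_le_inner (nuMatrix_isHermitian K p) (k := 0) (fun j => j.zero_le)
    (WithLp.toLp 2 ![√K.N * a, b])
  rw [inner_nuMatrix, EuclideanSpace.real_norm_sq_eq, Fin.sum_univ_two] at h
  simp only [Matrix.cons_val_zero, Matrix.cons_val_one, mul_pow, Real.sq_sqrt hN'.le] at h
  have hdiag : K.μ / K.N * (K.N * a ^ 2) = K.μ * a ^ 2 := by field_simp
  have hcross : 2 * (K.θ / √K.N) * (√K.N * a * b) = 2 * K.θ * a * b := by field_simp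
  rw [hdiag, hcross] at h
  rw [nu]
  linarith

theorem inner_nuMatrix_eq_sq_add (hN : 0 < K.N) (hμ : K.μ ≠ 0) (v : EuclideanSpace ℝ (Fin 2)) :
    inner ℝ v (Matrix.toEuclideanLin (nuMatrix K p) v)
      = K.μ * (v 0 / √K.N - K.θ / K.μ * v 1) ^ 2
        + (p.α * K.lam2 / p.ε - (K.θ ^ 2 / K.μ + K.θ)) * v 1 ^ 2 := by
  have hN' : (0 : ℝ) < K.N := by exact_mod_cast hN
  have hsqrt : √(K.N : ℝ) ≠ 0 := (Real.sqrt_pos.2 hN').ne'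
  have hsq : K.μ / K.N = K.μ / √K.N ^ 2 := by rw [Real.sq_sqrt hN'.le]
  rw [inner_nuMatrix, hsq]
  field_simp
  ring

theorem nu_pos (hN : 0 < K.N) (hμ : 0 < K.μ) (h : K.θ ^ 2 / K.μ + K.θ < p.α * K.lam2 / p.ε) :
    0 < nu K p := by
  obtain ⟨v, hnorm, hv⟩ := exists_unit_inner_apply_eq_sortedEig (nuMatrix_isHermitian K p) 0
  have : (0 : ℝ) < K.N := by exact_mod_cast hN
  have := sub_pos.2 h
  refine mul_pos two_pos ?_
  rw [← hv, inner_nuMatrix_eq_sq_add hN hμ.ne']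
  by_cases hv₁ : v 1 = 0
  · have hv₀ : v 0 ≠ 0 := fun hv₀ => by
      have : v = 0 := by ext i; fin_cases i <;> simpa
      simp [this] at hnorm
    rw [hv₁, mul_zero, sub_zero]
    positivity
  · positivity

theorem nu_congr {p' : Params} (h : p.α / p.ε = p'.α / p'.ε) : nu K p = nu K p' := by
  have hmatrix : nuMatrix K p = nuMatrix K p' := by
    simp only [nuMatrix, mul_div_right_comm, h]
  simp only [nu, hmatrix]

end Nu

section Decay

variable {E : Type*} [NormedAddCommGroup E] [InnerProductSpace ℝ E] {X X' : ℝ → E} {z : E}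
  {a b κ γ R : ℝ}

theorem norm_le_of_inner_deriv_le (hκ : 0 ≤ κ) (hX : ContinuousOn X (Icc a b))
    (hX' : ∀ t ∈ Ico a b, HasDerivWithinAt X (X' t) (Ici t) t) (ha : ‖X a‖ ≤ R)
    (hinner : ∀ t ∈ Ico a b, inner ℝ (X t) (X' t) ≤ κ * (R * ‖X t‖ - ‖X t‖ ^ 2)) :
    ∀ t ∈ Icc a b, ‖X t‖ ≤ R := by
  intro t ht
  have hR : 0 ≤ R := (norm_nonneg _).trans ha
  have hgronwall := le_gronwallBound_of_liminf_deriv_right_le (f := fun t => ‖X t‖ ^ 2 - R ^ 2)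
    (f' := fun t => 2 * inner ℝ (X t) (X' t)) (δ := 0) (K := -κ) (ε := 0)
    ((hX.norm.pow 2).sub continuousOn_const)
    (fun t ht r hr => ((hX' t ht).norm_sq.sub_const _).liminf_right_slope_le hr)
    (by simpa using pow_le_pow_left₀ (norm_nonneg _) ha 2)
    (fun t ht => by nlinarith only [hinner t ht, mul_nonneg hκ (sq_nonneg (R - ‖X t‖))]) t ht
  rw [gronwallBound_ε0_δ0, sub_nonpos] at hgronwall
  exact le_of_sq_le_sq hgronwall hR

theorem norm_sub_le_mul_exp_of_inner_deriv_le (hκ : 0 ≤ κ) (hX : ContinuousOn X (Icc a b))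
    (hX' : ∀ t ∈ Ico a b, HasDerivWithinAt X (X' t) (Ici t) t) (ha : ‖X a - z‖ ≤ R)
    (hinner : ∀ t ∈ Ico a b, inner ℝ (X t - z) (X' t)
      ≤ -(κ + γ) * ‖X t - z‖ ^ 2 + κ * (R * Real.exp (-γ * (t - a))) * ‖X t - z‖) :
    ∀ t ∈ Icc a b, ‖X t - z‖ ≤ R * Real.exp (-γ * (t - a)) := by
  set w : ℝ → ℝ := fun t => Real.exp (γ * (t - a)) with hw
  have hw_pos (t : ℝ) : 0 < w t := Real.exp_pos _
  have hw_inv (t : ℝ) : Real.exp (-γ * (t - a)) = (w t)⁻¹ := by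
    rw [hw, ← Real.exp_neg, neg_mul]
  have hw' (t : ℝ) : HasDerivAt w (γ * w t) t := by
    have := (((hasDerivAt_id t).sub_const a).const_mul γ).exp
    simpa only [hw, id, mul_one, mul_comm γ (Real.exp _)] using this
  have hnorm (t : ℝ) : ‖w t • (X t - z)‖ = w t * ‖X t - z‖ := by
    rw [norm_smul, Real.norm_of_nonneg (hw_pos t).le]
  have hbound : ∀ t ∈ Icc a b, ‖w t • (X t - z)‖ ≤ R := by
    refine norm_le_of_inner_deriv_le hκ
      ((Continuous.continuousOn (by fun_prop)).smul (hX.sub continuousOn_const))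
      (fun t ht => (hw' t).hasDerivWithinAt.smul ((hX' t ht).sub_const z))
      (by simpa [hw] using ha) fun t ht => ?_
    have hcancel : w t * (w t)⁻¹ = 1 := mul_inv_cancel₀ (hw_pos t).ne'
    calc inner ℝ (w t • (X t - z)) (w t • X' t + (γ * w t) • (X t - z))
        = w t ^ 2 * inner ℝ (X t - z) (X' t) + γ * (w t * ‖X t - z‖) ^ 2 := by
          rw [inner_add_right, real_inner_smul_left, real_inner_smul_right, real_inner_smul_left,
            real_inner_smul_right, real_inner_self_eq_norm_sq]
          ring
      _ ≤ w t ^ 2 * (-(κ + γ) * ‖X t - z‖ ^ 2 + κ * (R * (w t)⁻¹) * ‖X t - z‖)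
            + γ * (w t * ‖X t - z‖) ^ 2 := by
          gcongr
          rw [← hw_inv]
          exact hinner t ht
      _ = κ * (R * ‖w t • (X t - z)‖ - ‖w t • (X t - z)‖ ^ 2) := by
          rw [hnorm]
          linear_combination κ * R * ‖X t - z‖ * w t * hcancel
  intro t ht
  have := hbound t ht
  rw [hnorm] at this
  rw [hw_inv, ← div_eq_mul_inv, le_div_iff₀' (hw_pos t)]
  exact this

end Decay

section Drift

variable {E : Type*} [NormedAddCommGroup E] [NormedSpace ℝ E] {X X' : ℝ → E} {a b c v : ℝ}

theorem exp_sub_one_le_two_mul {x : ℝ} (h₀ : 0 ≤ x) (h₁ : x ≤ 1) : Real.exp x - 1 ≤ 2 * x := by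
  have := Real.abs_exp_sub_one_le (abs_le.2 ⟨by linarith, h₁⟩)
  rw [abs_of_nonneg h₀] at this
  exact (le_abs_self _).trans this

theorem gronwallBound_zero_le_two_mul {x : ℝ} (hc : 0 ≤ c) (hv : 0 ≤ v) (hx : 0 ≤ x)
    (hcx : c * x ≤ 1) : gronwallBound 0 c v x ≤ 2 * v * x := by
  rcases hc.eq_or_lt with rfl | hc
  · simp only [gronwallBound_K0, zero_add]
    nlinarith [mul_nonneg hv hx]
  · simp only [gronwallBound_of_K_ne_0 hc.ne', zero_mul, zero_add]
    calc v / c * (Real.exp (c * x) - 1) ≤ v / c * (2 * (c * x)) := by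
          gcongr
          exact exp_sub_one_le_two_mul (by positivity) hcx
      _ = 2 * v * x := by field_simp

theorem norm_sub_le_two_mul_of_norm_deriv_le (hc : 0 ≤ c) (hv : 0 ≤ v) (hcb : c * (b - a) ≤ 1)
    (hX : ContinuousOn X (Icc a b)) (hX' : ∀ t ∈ Ico a b, HasDerivWithinAt X (X' t) (Ici t) t)
    (hnorm : ∀ t ∈ Ico a b, ‖X' t‖ ≤ c * ‖X t - X a‖ + v) :
    ∀ t ∈ Icc a b, ‖X t - X a‖ ≤ 2 * v * (b - a) := by
  intro t ht
  have ht' : c * (t - a) ≤ c * (b - a) := by gcongr; exact ht.2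
  calc ‖X t - X a‖ ≤ gronwallBound 0 c v (t - a) :=
        norm_le_gronwallBound_of_norm_deriv_right_le (hX.sub continuousOn_const)
          (fun t ht => (hX' t ht).sub_const _) (by simp) hnorm t ht
    _ ≤ 2 * v * (t - a) :=
        gronwallBound_zero_le_two_mul hc hv (sub_nonneg.2 ht.1) (ht'.trans hcb)
    _ ≤ 2 * v * (b - a) := by gcongr; exact ht.2

end Drift

section SampledDissipative

variable {E : Type*} [NormedAddCommGroup E] [InnerProductSpace ℝ E]

/-- A vector field `f H`, driven by a held copy `H` of the state, pulls the state towards `z` at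
rate `a` up to a perturbation proportional to the hold error `‖H - X‖`, and has linearly bounded
speed. -/
structure SampledDissipative (f : E → E → E) (z : E) (a b c : ℝ) : Prop where
  inner_le : ∀ H X, inner ℝ (X - z) (f H X) ≤ -a * ‖X - z‖ ^ 2 + b * ‖H - X‖ * ‖X - z‖
  norm_le : ∀ H X, ‖f H X‖ ≤ b * ‖H - z‖ + c * ‖X - z‖

variable {f : E → E → E} {z H : E} {a b c γ η η' R T t₀ : ℝ} {X : ℝ → E}

theorem SampledDissipative.norm_hold_sub_le (hf : SampledDissipative f z a b c) (hb : 0 ≤ b)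
    (hc : 0 ≤ c) (hη : 0 ≤ η) (hcT : c * T ≤ 1)
    (hX : ContinuousOn X (Icc t₀ (t₀ + T)))
    (hX' : ∀ t ∈ Ico t₀ (t₀ + T), HasDerivWithinAt X (f H (X t)) (Ici t) t)
    (hR : ‖X t₀ - z‖ ≤ R) (hH : ‖H - X t₀‖ ≤ η * R) :
    ∀ t ∈ Icc t₀ (t₀ + T), ‖H - X t‖ ≤ (η + 2 * (b * (η + 1) + c) * T) * R := by
  have hR₀ : 0 ≤ R := (norm_nonneg _).trans hR
  have hHz : ‖H - z‖ ≤ (η + 1) * R := by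
    linarith [norm_sub_le_norm_sub_add_norm_sub H (X t₀) z]
  have hspeed : ∀ t ∈ Ico t₀ (t₀ + T),
      ‖f H (X t)‖ ≤ c * ‖X t - X t₀‖ + (b * (η + 1) + c) * R := fun t _ =>
    calc ‖f H (X t)‖ ≤ b * ‖H - z‖ + c * ‖X t - z‖ := hf.norm_le H (X t)
      _ ≤ b * ((η + 1) * R) + c * (‖X t - X t₀‖ + R) := by
          gcongr
          exact (norm_sub_le_norm_sub_add_norm_sub _ (X t₀) _).trans (by gcongr)
      _ = _ := by ring
  intro t ht
  have hdrift : ‖X t - X t₀‖ ≤ 2 * ((b * (η + 1) + c) * R) * (t₀ + T - t₀) :=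
    norm_sub_le_two_mul_of_norm_deriv_le hc (by positivity) (by rwa [add_sub_cancel_left])
      hX hX' hspeed t ht
  calc ‖H - X t‖ ≤ ‖H - X t₀‖ + ‖X t - X t₀‖ := by
        rw [norm_sub_rev (X t)]
        exact norm_sub_le_norm_sub_add_norm_sub _ _ _
    _ ≤ η * R + 2 * ((b * (η + 1) + c) * R) * (t₀ + T - t₀) := add_le_add hH hdrift
    _ = _ := by ring

theorem SampledDissipative.norm_le_mul_exp_of_mem_Icc (hf : SampledDissipative f z a b c)
    (hb : 0 ≤ b) (hc : 0 ≤ c) (hη : 0 ≤ η) (hγ : 0 ≤ γ) (hγa : γ ≤ a) (hη' : b * η' = a - γ)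
    (hcT : c * T ≤ 1) (hdrift : Real.exp (γ * T) * (η + 2 * (b * (η + 1) + c) * T) ≤ η')
    (hX : ContinuousOn X (Icc t₀ (t₀ + T)))
    (hX' : ∀ t ∈ Ico t₀ (t₀ + T), HasDerivWithinAt X (f H (X t)) (Ici t) t)
    (hR : ‖X t₀ - z‖ ≤ R) (hH : ‖H - X t₀‖ ≤ η * R) :
    ∀ t ∈ Icc t₀ (t₀ + T), ‖X t - z‖ ≤ R * Real.exp (-γ * (t - t₀)) ∧
      ‖H - X t‖ ≤ η' * R * Real.exp (-γ * (t - t₀)) := by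
  have hR₀ : 0 ≤ R := (norm_nonneg _).trans hR
  have hhold : ∀ t ∈ Icc t₀ (t₀ + T), ‖H - X t‖ ≤ η' * R * Real.exp (-γ * (t - t₀)) := by
    intro t ht
    have hT : t - t₀ ≤ T := by linarith [ht.2]
    have hT₀ : 0 ≤ T := by linarith [ht.1]
    have hη'_nonneg : 0 ≤ η' := hdrift.trans' (by positivity)
    calc ‖H - X t‖ ≤ (η + 2 * (b * (η + 1) + c) * T) * R :=
          hf.norm_hold_sub_le hb hc hη hcT hX hX' hR hH t ht
      _ ≤ (η' * Real.exp (-γ * T)) * R := by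
          gcongr
          rwa [neg_mul, Real.exp_neg, ← div_eq_mul_inv, le_div_iff₀' (Real.exp_pos _)]
      _ = η' * R * Real.exp (-γ * T) := by ring
      _ ≤ η' * R * Real.exp (-γ * (t - t₀)) := by
          gcongr ?_ * Real.exp ?_
          nlinarith
  have hstate := norm_sub_le_mul_exp_of_inner_deriv_le (γ := γ) (sub_nonneg.2 hγa) hX hX' hR
    fun t ht => (hf.inner_le H (X t)).trans <| by
      rw [sub_add_cancel, ← hη']
      have := hhold t (Ico_subset_Icc_self ht)
      calc -a * ‖X t - z‖ ^ 2 + b * ‖H - X t‖ * ‖X t - z‖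
          ≤ -a * ‖X t - z‖ ^ 2 + b * (η' * R * Real.exp (-γ * (t - t₀))) * ‖X t - z‖ := by gcongr
        _ = _ := by ring
  exact fun t ht => ⟨hstate t ht, hhold t ht⟩

theorem exists_mem_Ico_nat_mul {t : ℝ} (hT : 0 < T) (ht : 0 ≤ t) :
    ∃ k : ℕ, t ∈ Ico (k * T) ((k + 1) * T) :=
  ⟨⌊t / T⌋₊, (le_div_iff₀ hT).1 (Nat.floor_le (div_nonneg ht hT.le)),
    (div_lt_iff₀ hT).1 (Nat.lt_floor_add_one _)⟩

theorem SampledDissipative.norm_le_mul_exp (hf : SampledDissipative f z a b c)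
    (hb : 0 ≤ b) (hc : 0 ≤ c) (hη : 0 ≤ η) (hγ : 0 ≤ γ) (hγa : γ ≤ a) (hη' : b * η' = a - γ)
    (hT : 0 < T) (hcT : c * T ≤ 1)
    (hdrift : Real.exp (γ * T) * (η + 2 * (b * (η + 1) + c) * T) ≤ η')
    {H : ℕ → E} (hX : ContinuousOn X (Ici 0))
    (hX' : ∀ k : ℕ, ∀ t ∈ Ico (k * T) ((k + 1) * T),
      HasDerivWithinAt X (f (H k) (X t)) (Ici t) t)
    (hR : ‖X 0 - z‖ ≤ R) (hH₀ : ‖H 0 - X 0‖ ≤ η * R)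
    (hH : ∀ k : ℕ,
      ‖H k - X ((k + 1 : ℕ) * T)‖ ≤ η' * R * Real.exp (-γ * ((k + 1 : ℕ) * T)) →
      ‖H (k + 1) - X ((k + 1 : ℕ) * T)‖ ≤ η * R * Real.exp (-γ * ((k + 1 : ℕ) * T)))
    {t : ℝ} (ht : 0 ≤ t) : ‖X t - z‖ ≤ R * Real.exp (-γ * t) := by
  have hperiod (k : ℕ) (hXk : ‖X (k * T) - z‖ ≤ R * Real.exp (-γ * (k * T)))
      (hHk : ‖H k - X (k * T)‖ ≤ η * R * Real.exp (-γ * (k * T))) :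
      ∀ t ∈ Icc (k * T) ((k + 1) * T), ‖X t - z‖ ≤ R * Real.exp (-γ * t) ∧
        ‖H k - X t‖ ≤ η' * R * Real.exp (-γ * t) := by
    have hend : ((k : ℝ) + 1) * T = k * T + T := by ring
    have hexp (t : ℝ) :
        Real.exp (-γ * (k * T)) * Real.exp (-γ * (t - k * T)) = Real.exp (-γ * t) := by
      rw [← Real.exp_add]
      congr 1
      ring
    have hsub : Icc (k * T) (k * T + T) ⊆ Ici 0 := fun s hs => le_trans (by positivity) hs.1
    rw [hend]
    intro t ht
    have := hf.norm_le_mul_exp_of_mem_Icc hb hc hη hγ hγa hη' hcT hdrift (hX.mono hsub)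
      (hend ▸ hX' k) hXk (hHk.trans_eq (mul_assoc _ _ _)) t ht
    rw [← hexp t]
    exact ⟨this.1.trans_eq (mul_assoc _ _ _), this.2.trans_eq (by ring)⟩
  have hsample (k : ℕ) : ‖X (k * T) - z‖ ≤ R * Real.exp (-γ * (k * T)) ∧
      ‖H k - X (k * T)‖ ≤ η * R * Real.exp (-γ * (k * T)) := by
    induction k with
    | zero => simpa using ⟨hR, hH₀⟩
    | succ k ih =>
      have := hperiod k ih.1 ih.2 ((k + 1 : ℕ) * T) ⟨by push_cast; linarith, by push_cast; rfl⟩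
      exact ⟨this.1, hH k this.2⟩
  obtain ⟨k, hk⟩ := exists_mem_Ico_nat_mul hT ht
  exact (hperiod k (hsample k).1 (hsample k).2 t (Ico_subset_Icc_self hk)).1

end SampledDissipative

section SampledExistence

variable {E : Type*} [NormedAddCommGroup E] [NormedSpace ℝ E] {T : ℝ}

theorem exists_solution_of_lipschitzWith [CompleteSpace E] {f : E → E} {κ : NNReal}
    (hf : LipschitzWith κ f) (hT : 0 ≤ T) (hκT : κ * T ≤ 1 / 2) (x₀ : E) :
    ∃ φ : ℝ → E, φ 0 = x₀ ∧ ∀ t ∈ Icc 0 T, HasDerivWithinAt φ (f (φ t)) (Icc 0 T) t := by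
  set a : NNReal := ⟨2 * T * ‖f x₀‖, by positivity⟩
  have ha : (a : ℝ) = 2 * T * ‖f x₀‖ := rfl
  have hpicard : IsPicardLindelof (fun _ => f) (⟨0, le_rfl, hT⟩ : Icc 0 T) x₀ a 0
      (‖f x₀‖₊ + κ * a) κ := by
    refine IsPicardLindelof.of_time_independent (fun x hx => ?_) hf.lipschitzOnWith ?_
    · push_cast
      have hball : ‖x - x₀‖ ≤ a := by rwa [← dist_eq_norm, ← Metric.mem_closedBall]
      calc ‖f x‖ ≤ ‖f x - f x₀‖ + ‖f x₀‖ := norm_le_norm_sub_add _ _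
        _ ≤ κ * a + ‖f x₀‖ := by
            gcongr
            exact (hf.norm_sub_le x x₀).trans (by gcongr)
        _ = ‖f x₀‖ + κ * a := add_comm _ _
    · simp only [sub_zero, NNReal.coe_zero, sub_self]
      rw [max_eq_left hT]
      push_cast
      have : (κ * T) * a ≤ 1 / 2 * a := by gcongr
      rw [ha] at this ⊢
      linarith
  exact hpicard.exists_eq_forall_mem_Icc_hasDerivWithinAt₀

theorem continuousOn_Ici_of_forall_Icc {Y : Type*} [TopologicalSpace Y] {f : ℝ → Y}
    (hT : 0 < T) (h : ∀ k : ℕ, ContinuousOn f (Icc (k * T) ((k + 1) * T))) :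
    ContinuousOn f (Ici 0) := by
  have hinit (k : ℕ) : ContinuousOn f (Icc 0 (k * T)) := by
    induction k with
    | zero => simp
    | succ k ih =>
      have hunion : Icc 0 ((k + 1 : ℕ) * T) = Icc 0 (k * T) ∪ Icc (k * T) ((k + 1) * T) := by
        rw [Icc_union_Icc_eq_Icc (by positivity) (by nlinarith)]
        push_cast
        rfl
      rw [hunion]
      exact ih.union_of_isClosed (h k) isClosed_Icc isClosed_Icc
  intro t ht
  obtain ⟨k, hk⟩ := exists_nat_gt (t / T)
  rw [div_lt_iff₀ hT] at hk
  refine (hinit k t ⟨ht, hk.le⟩).mono_of_mem_nhdsWithin ?_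
  exact mem_nhdsWithin.2 ⟨Iio (k * T), isOpen_Iio, hk, fun x hx => ⟨hx.2, hx.1.le⟩⟩

theorem exists_concatenation (hT : 0 < T) {V : ℕ → E → E} {φ : ℕ → ℝ → E}
    (hφ : ∀ k, ∀ t ∈ Icc 0 T, HasDerivWithinAt (φ k) (V k (φ k t)) (Icc 0 T) t)
    (hjoin : ∀ k, φ (k + 1) 0 = φ k T) :
    ∃ X : ℝ → E, ContinuousOn X (Ici 0) ∧ (∀ k : ℕ, X (k * T) = φ k 0) ∧
      ∀ k : ℕ, ∀ t ∈ Ico (k * T) ((k + 1) * T),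
        HasDerivWithinAt X (V k (X t)) (Ico (k * T) ((k + 1) * T)) t := by
  let X (t : ℝ) : E := φ ⌊t / T⌋₊ (t - ⌊t / T⌋₊ * T)
  have hX_Ico (k : ℕ) (t : ℝ) (ht : t ∈ Ico (k * T) ((k + 1) * T)) : X t = φ k (t - k * T) := by
    have : ⌊t / T⌋₊ = k := by
      rw [Nat.floor_eq_iff (div_nonneg (le_trans (by positivity) ht.1) hT.le)]
      exact ⟨(le_div_iff₀ hT).2 ht.1, (div_lt_iff₀ hT).2 ht.2⟩
    simp only [X, this]
  have hX_sample (k : ℕ) : X (k * T) = φ k 0 := by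
    rw [hX_Ico k _ ⟨le_rfl, by linarith⟩, sub_self]
  have hX_Icc (k : ℕ) (t : ℝ) (ht : t ∈ Icc (k * T) ((k + 1) * T)) : X t = φ k (t - k * T) := by
    rcases ht.2.lt_or_eq with hlt | rfl
    · exact hX_Ico k t ⟨ht.1, hlt⟩
    · have := hX_sample (k + 1)
      push_cast at this
      rw [this, hjoin]
      congr 1
      ring
  have hX_deriv (k : ℕ) (t : ℝ) (ht : t ∈ Icc (k * T) ((k + 1) * T)) :
      HasDerivWithinAt X (V k (X t)) (Icc (k * T) ((k + 1) * T)) t := by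
    have hmaps : MapsTo (fun t => t - k * T) (Icc (k * T) ((k + 1) * T)) (Icc 0 T) :=
      fun u hu => ⟨by linarith [hu.1], by linarith [hu.2]⟩
    have := (hφ k _ (hmaps ht)).scomp t ((hasDerivWithinAt_id t _).sub_const (k * T)) hmaps
    rw [one_smul, ← hX_Icc k t ht] at this
    exact this.congr (hX_Icc k) (hX_Icc k t ht)
  exact ⟨X, continuousOn_Ici_of_forall_Icc hT fun k t ht => (hX_deriv k t ht).continuousWithinAt,
    hX_sample, fun k t ht => (hX_deriv k t (Ico_subset_Icc_self ht)).mono Ico_subset_Icc_self⟩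

theorem exists_sampled_solution [CompleteSpace E] {S : Type*} {f : S → E → E} {κ : NNReal}
    (hf : ∀ h, LipschitzWith κ (f h)) (hT : 0 < T) (hκT : κ * T ≤ 1 / 2)
    (update : ℕ → S → E → S) (h₀ : S) (x₀ : E) :
    ∃ (X : ℝ → E) (h : ℕ → S), X 0 = x₀ ∧ ContinuousOn X (Ici 0) ∧ h 0 = h₀ ∧
      (∀ k : ℕ, h (k + 1) = update k (h k) (X ((k + 1 : ℕ) * T))) ∧
      ∀ k : ℕ, ∀ t ∈ Ico (k * T) ((k + 1) * T),
        HasDerivWithinAt X (f (h k) (X t)) (Ico (k * T) ((k + 1) * T)) t := by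
  choose φ hφ₀ hφ using fun h => exists_solution_of_lipschitzWith (hf h) hT.le hκT
  let step (k : ℕ) (s : E × S) : E × S :=
    (φ s.2 s.1 T, update k s.2 (φ s.2 s.1 T))
  let seq (k : ℕ) : E × S := Nat.rec (x₀, h₀) step k
  have hseq (k : ℕ) : seq (k + 1) = step k (seq k) := rfl
  obtain ⟨X, hX, hX_sample, hX'⟩ := exists_concatenation hT
    (φ := fun k => φ (seq k).2 (seq k).1) (fun k => hφ (seq k).2 (seq k).1)
    (fun k => by rw [hφ₀, hseq])
  refine ⟨X, fun k => (seq k).2, ?_, hX, rfl, fun k => ?_, hX'⟩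
  · simpa [hφ₀, seq] using hX_sample 0
  · rw [hX_sample, hφ₀, hseq]

end SampledExistence

section Quantizer

variable {N : ℕ} {n : Fin N → ℕ} {L : ℕ} {s : ℝ}

theorem abs_min_floor_sub_le {y : ℝ} (hy : y ≤ L + 1 / 2) :
    |((min ⌊y + 1 / 2⌋ (L : ℤ) : ℤ) : ℝ) - y| ≤ 1 / 2 := by
  have hle := Int.floor_le (y + 1 / 2)
  have hlt := Int.lt_floor_add_one (y + 1 / 2)
  push_cast
  rw [abs_le]
  rcases le_total (⌊y + 1 / 2⌋ : ℝ) (L : ℝ) with h | h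
  · rw [min_eq_left h]
    constructor <;> linarith
  · rw [min_eq_right h]
    constructor <;> linarith

theorem abs_quant_sub_le {x : ℝ} (hx : |x| ≤ L + 1 / 2) : |(quant L x : ℝ) - x| ≤ 1 / 2 := by
  rw [abs_le] at hx
  unfold quant
  split_ifs with hsmall hpos
  · rw [Int.cast_zero, zero_sub, abs_neg, abs_le]
    exact ⟨hsmall.1.le, hsmall.2.le⟩
  · exact abs_min_floor_sub_le hx.2
  · rw [Int.cast_neg, ← neg_add', abs_neg, ← sub_neg_eq_add]
    exact abs_min_floor_sub_le (by linarith)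

/-- The decoders' new values when the players encode the state `V`, and `W` was decoded from the
previous sample, with scaling `s`. -/
noncomputable def requantize (L : ℕ) (s : ℝ) (V W : State n) : State n :=
  WithLp.toLp 2 fun i => W i + s • (encode L s (V i) (W i)).toProfile

theorem requantize_apply_apply (V W : State n) (i k : Fin N) (c : Fin (n k)) :
    requantize L s V W i k c = W i k c + s * quant L ((V i k c - W i k c) / s) := rfl

theorem abs_requantize_sub_le (hs : 0 < s) {V W : State n} {i k : Fin N} {c : Fin (n k)}
    (h : |V i k c - W i k c| ≤ (L + 1 / 2) * s) :
    |(requantize L s V W - V) i k c| ≤ s / 2 := by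
  set e := (V i k c - W i k c) / s with he
  have he_le : |e| ≤ L + 1 / 2 := by rwa [abs_div, abs_of_pos hs, div_le_iff₀ hs]
  calc |(requantize L s V W - V) i k c| = |s * (quant L e - e)| := by
        congr 1
        simp only [PiLp.sub_apply, requantize_apply_apply, he]
        field_simp
        ring
    _ = s * |quant L e - e| := by rw [abs_mul, abs_of_pos hs]
    _ ≤ s * (1 / 2) := by gcongr; exact abs_quant_sub_le he_le
    _ = s / 2 := by ring

theorem abs_apply_apply_le_norm (X : State n) (i k : Fin N) (c : Fin (n k)) :
    |X i k c| ≤ ‖X‖ :=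
  (PiLp.norm_apply_le (X i k) c).trans <|
    (PiLp.norm_apply_le (X i) k).trans (PiLp.norm_apply_le X i)

theorem norm_le_of_forall_abs_le {X : State n} {r : ℝ} (hr : 0 ≤ r)
    (h : ∀ i k (c : Fin (n k)), |X i k c| ≤ r) :
    ‖X‖ ≤ √((N : ℝ) * (∑ i, n i : ℕ)) * r := by
  refine le_of_sq_le_sq ?_ (by positivity)
  calc ‖X‖ ^ 2 = ∑ k, ∑ c : Fin (n k), ∑ i, X i k c ^ 2 := by
        simp only [norm_sq_eq_sum_norm_slice_sq, EuclideanSpace.real_norm_sq_eq, slice]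
    _ ≤ ∑ k, ∑ _c : Fin (n k), ∑ _i : Fin N, r ^ 2 := by
        refine Finset.sum_le_sum fun k _ => Finset.sum_le_sum fun c _ => Finset.sum_le_sum
          fun i _ => sq_le_sq' ?_ ?_
        exacts [(abs_le.1 (h i k c)).1, (abs_le.1 (h i k c)).2]
    _ = (√((N : ℝ) * (∑ i, n i : ℕ)) * r) ^ 2 := by
        rw [mul_pow, Real.sq_sqrt (by positivity)]
        simp only [Finset.sum_const, Finset.card_univ, Fintype.card_fin, nsmul_eq_mul,
          ← Finset.sum_mul, Nat.cast_sum]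
        ring

theorem norm_requantize_sub_le (hs : 0 < s) {V W : State n}
    (h : ∀ i k (c : Fin (n k)), |V i k c - W i k c| ≤ (L + 1 / 2) * s) :
    ‖requantize L s V W - V‖ ≤ √((N : ℝ) * (∑ i, n i : ℕ)) * (s / 2) :=
  norm_le_of_forall_abs_le (by positivity) fun i k c => abs_requantize_sub_le hs (h i k c)

end Quantizer

section Bandwidth

variable {N : ℕ} {T : ℝ}

theorem finsum_sampling_eq {t : ℝ} (hT : 0 < T) (ht : 0 ≤ t) (b : ℝ) :
    ∑ᶠ (k : ℕ) (_ : (k : ℝ) * T ≤ t), b = (⌊t / T⌋₊ + 1 : ℕ) * b := by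
  have hmem (k : ℕ) : (k : ℝ) * T ≤ t ↔ k ∈ Finset.range (⌊t / T⌋₊ + 1) := by
    rw [Finset.mem_range, Nat.lt_succ_iff, Nat.le_floor_iff (by positivity), le_div_iff₀ hT]
  simp_rw [hmem]
  rw [finsum_mem_finset_eq_sum (fun _ : ℕ => b), Finset.sum_const, Finset.card_range,
    nsmul_eq_mul]

theorem tendsto_sampling_rate (hT : 0 < T) (b : ℝ) :
    Tendsto (fun t : ℝ => (1 / t) * ∑ᶠ (k : ℕ) (_ : (k : ℝ) * T ≤ t), b) atTop (𝓝 (b / T)) := by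
  have hfloor : Tendsto (fun t : ℝ => (⌊T⁻¹ * t⌋₊ : ℝ) / t) atTop (𝓝 T⁻¹) :=
    tendsto_nat_floor_mul_div_atTop (by positivity)
  have hlim := (hfloor.mul_const b).add (tendsto_inv_atTop_zero.mul_const b)
  rw [zero_mul, add_zero, inv_mul_eq_div] at hlim
  refine hlim.congr' ?_
  filter_upwards [eventually_gt_atTop 0] with t ht
  rw [finsum_sampling_eq hT ht.le, inv_mul_eq_div T t]
  push_cast
  field_simp

theorem algBandwidth_eq {G : WGraph N} (hN : 2 ≤ N) (hG : G.graph.Preconnected) (K : Consts)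
    {p : Params} (hT : 0 < p.T) :
    algBandwidth G K p = ((bitsPerSample K p.L / p.T : ℝ) : EReal) := by
  have hedge : limsup (fun t : ℝ => (((1 / t) * ∑ᶠ (k : ℕ) (_ : (k : ℝ) * p.T ≤ t),
      bitsPerSample K p.L : ℝ) : EReal)) atTop = ((bitsPerSample K p.L / p.T : ℝ) : EReal) :=
    ((continuous_coe_real_ereal.tendsto _).comp (tendsto_sampling_rate hT _)).limsup_eq
  have : Nontrivial (Fin N) := Fin.nontrivial_iff_two_le.2 hN
  obtain ⟨j, hadj⟩ := hG.exists_adj_of_nontrivial ⟨0, by omega⟩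
  unfold algBandwidth bandwidth
  simp_rw [hedge]
  exact le_antisymm (iSup_le fun _ => iSup_le fun _ => iSup_le fun _ => le_rfl)
    (le_iSup_of_le _ (le_iSup_of_le j (le_iSup_of_le hadj le_rfl)))

end Bandwidth

section Dynamics

variable {N : ℕ} {n : Fin N → ℕ} {J : Fin N → Profile n → ℝ} {G : WGraph N} {μ : ℝ}
  {θown θoth : Fin N → ℝ} {K : Consts} {p : Params} {x : ℝ → Fin N → Profile n}

/-- The right-hand side of the dynamics on joint states, when the decoders hold the value `H`. -/
noncomputable def field (J : Fin N → Profile n → ℝ) (G : WGraph N) (p : Params)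
    (H X : State n) : State n :=
  -(p.α • lapState G H) - p.ε • embed (diagGrad J X)

theorem field_apply (H X : State n) (i : Fin N) :
    field J G p H X i = p.α • ∑ j, G.a i j • (H j - H i)
      - (WithLp.toLp 2 (Pi.single i (p.ε • ownGrad J i (X i))) : Profile n) := by
  have hlap : lapState G H i = -∑ j, G.a i j • (H j - H i) := by
    simp only [lapState_apply, ← Finset.sum_neg_distrib, ← smul_neg, neg_sub]
  have hembed : p.ε • embed (diagGrad J X) i
      = (WithLp.toLp 2 (Pi.single i (p.ε • ownGrad J i (X i))) : Profile n) := by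
    rw [embed_apply, ← WithLp.toLp_smul, ← Pi.single_smul]
    rfl
  simp only [field, PiLp.sub_apply, PiLp.neg_apply, PiLp.smul_apply]
  rw [hlap, hembed, smul_neg, neg_neg]

theorem lipschitzWith_field (hF : MapAssumption J μ θown θoth) (hε : 0 ≤ p.ε) (H : State n) :
    LipschitzWith (p.ε * lipConst θown θoth).toNNReal (field J G p H) := by
  refine LipschitzWith.of_dist_le_mul fun X Y => ?_
  have hsub : field J G p H X - field J G p H Y
      = -(p.ε • embed (diagGrad J X - diagGrad J Y)) := by
    rw [field, field, map_sub, smul_sub]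
    abel
  rw [Real.coe_toNNReal _ (mul_nonneg hε (lipConst_nonneg _ _)), dist_eq_norm, dist_eq_norm, hsub,
    norm_neg, norm_smul, norm_embed, Real.norm_of_nonneg hε, mul_assoc]
  gcongr
  exact norm_diagGrad_sub_le hF X Y

/-- The joint state of the decoders after sample `k`. -/
noncomputable def hatState (K : Consts) (p : Params) (x : ℝ → Fin N → Profile n) (k : ℕ) :
    State n :=
  WithLp.toLp 2 fun j => hat K p x j k

theorem hatState_zero (K : Consts) (p : Params) (x : ℝ → Fin N → Profile n) :
    hatState K p x 0 = requantize p.L (scale K p 0) (WithLp.toLp 2 (x 0)) 0 := by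
  ext1 j
  simp only [hatState, hat, decoded, requantize, Nat.cast_zero, zero_mul, PiLp.zero_apply, zero_add]

theorem hatState_succ (K : Consts) (p : Params) (x : ℝ → Fin N → Profile n) (k : ℕ) :
    hatState K p x (k + 1) = requantize p.L (scale K p (k + 1))
      (WithLp.toLp 2 (x ((k + 1 : ℕ) * p.T))) (hatState K p x k) := rfl

theorem exists_isTrajectory (hF : MapAssumption J μ θown θoth) (G : WGraph N) (K : Consts)
    (hε : 0 ≤ p.ε) (hT : 0 < p.T) (hshort : p.ε * lipConst θown θoth * p.T ≤ 1 / 2)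
    (x₀ : Fin N → Profile n) : ∃ x, IsTrajectory J G K p x ∧ x 0 = x₀ := by
  obtain ⟨X, H, hX₀, hX, hH₀, hH, hX'⟩ := exists_sampled_solution
    (lipschitzWith_field (G := G) hF hε) hT
    (by rwa [Real.coe_toNNReal _ (mul_nonneg hε (lipConst_nonneg _ _))])
    (fun k H X => requantize p.L (scale K p (k + 1)) X H)
    (requantize p.L (scale K p 0) (WithLp.toLp 2 x₀) 0) (WithLp.toLp 2 x₀)
  have hhat (k : ℕ) : hatState K p (fun t i => X t i) k = H k := by
    induction k with
    | zero => simp only [hatState_zero, hX₀, hH₀]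
    | succ k ih => rw [hatState_succ, ih, hH]
  refine ⟨fun t i => X t i, ⟨fun i => ?_, fun i k t ht => ?_⟩, by simp only [hX₀]⟩
  · exact (PiLp.continuous_apply 2 _ i).comp_continuousOn hX
  · have hode := (PiLp.hasFDerivAt_apply (𝕜 := ℝ) 2 (X t) i).comp_hasDerivWithinAt t (hX' k t ht)
    rw [← hhat k] at hode
    exact hode.congr_deriv (field_apply _ _ i)

theorem IsTrajectory.continuousOn_state (hx : IsTrajectory J G K p x) :
    ContinuousOn (fun t => (WithLp.toLp 2 (x t) : State n)) (Ici 0) :=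
  (PiLp.continuous_toLp 2 _).comp_continuousOn (continuousOn_pi.2 hx.continuousOn)

theorem IsTrajectory.hasDerivWithinAt_state (hx : IsTrajectory J G K p x) (k : ℕ) {t : ℝ}
    (ht : t ∈ Ico (k * p.T) ((k + 1) * p.T)) :
    HasDerivWithinAt (fun t => (WithLp.toLp 2 (x t) : State n))
      (field J G p (hatState K p x k) (WithLp.toLp 2 (x t))) (Ici t) t := by
  have hcoord : HasDerivWithinAt x
      (fun i => field J G p (hatState K p x k) (WithLp.toLp 2 (x t)) i)
      (Ico (k * p.T) ((k + 1) * p.T)) t :=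
    hasDerivWithinAt_pi.2 fun i => by
      rw [field_apply]
      exact hx.ode i k t ht
  refine ((PiLp.hasFDerivAt_toLp (𝕜 := ℝ) 2 (x t)).comp_hasDerivWithinAt t
    hcoord).mono_of_mem_nhdsWithin ?_
  exact mem_of_superset (Ico_mem_nhdsGE ht.2) (Ico_subset_Ico_left ht.1)

end Dynamics

section Dissipativity

variable {N : ℕ} {n : Fin N → ℕ} {J : Fin N → Profile n → ℝ} {G : WGraph N} {μ : ℝ}
  {θown θoth : Fin N → ℝ} {M M' : ℝ} {K : Consts} {p : Params} {xs : Profile n}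

theorem inner_field_self_le {hN : 2 ≤ N} (hG : G.graph.Preconnected)
    (hF : MapAssumption J μ θown θoth) (hxs : gameMap J xs = 0) (hε : 0 < p.ε) (hα : 0 ≤ p.α)
    (hK : K = consts hN n G μ θown θoth M M') (X : State n) :
    inner ℝ (X - consensus xs) (field J G p X X)
      ≤ -(p.ε * nu K p / 2) * ‖X - consensus xs‖ ^ 2 := by
  subst hK
  set K := consts hN n G μ θown θoth M M' with hK
  set a := ‖average X - xs‖
  set b := ‖X - consensus (average X)‖
  have hlap : K.lam2 * b ^ 2 ≤ inner ℝ (X - consensus xs) (lapState G X) :=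
    sortedEig_mul_norm_sub_average_sq_le hG le_rfl X xs
  have hgrad : K.μ * a ^ 2 - 2 * K.θ * a * b - K.θ * b ^ 2
      ≤ inner ℝ (X - consensus xs) (embed (diagGrad J X)) :=
    le_inner_embed_diagGrad hF X hxs (average X)
  have hν : nu K p / 2 * ‖X - consensus xs‖ ^ 2
      ≤ K.μ * a ^ 2 - 2 * K.θ * a * b + (p.α * K.lam2 / p.ε - K.θ) * b ^ 2 := by
    rw [norm_sub_consensus_sq]
    exact half_nu_mul_le (by simp only [hK, consts]; omega) a b
  calc inner ℝ (X - consensus xs) (field J G p X X)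
      = -(p.α * inner ℝ (X - consensus xs) (lapState G X))
          - p.ε * inner ℝ (X - consensus xs) (embed (diagGrad J X)) := by
        rw [field, inner_sub_right, inner_neg_right, real_inner_smul_right, real_inner_smul_right]
    _ ≤ -(p.α * (K.lam2 * b ^ 2)) - p.ε * (K.μ * a ^ 2 - 2 * K.θ * a * b - K.θ * b ^ 2) := by
        gcongr
    _ = -(p.ε * (K.μ * a ^ 2 - 2 * K.θ * a * b + (p.α * K.lam2 / p.ε - K.θ) * b ^ 2)) := by
        field_simp
        ring
    _ ≤ -(p.ε * (nu K p / 2 * ‖X - consensus xs‖ ^ 2)) := by gcongr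
    _ = _ := by ring

theorem norm_lapState_le_lamN {hN : 2 ≤ N} (hK : K = consts hN n G μ θown θoth M M')
    (X : State n) : ‖lapState G X‖ ≤ K.lamN * ‖X‖ := by
  subst hK
  exact norm_lapState_le G (fun j => Nat.le_sub_one_of_lt j.isLt) X

theorem norm_field_le {hN : 2 ≤ N} (hF : MapAssumption J μ θown θoth) (hxs : gameMap J xs = 0)
    (hε : 0 ≤ p.ε) (hα : 0 ≤ p.α) (hK : K = consts hN n G μ θown θoth M M') (H X : State n) :
    ‖field J G p H X‖
      ≤ p.α * K.lamN * ‖H - consensus xs‖ + p.ε * K.θ * ‖X - consensus xs‖ := by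
  have hlapH : lapState G H = lapState G (H - consensus xs) := by
    rw [map_sub, lapState_consensus, sub_zero]
  have hgrad : ‖diagGrad J X‖ ≤ K.θ * ‖X - consensus xs‖ := by
    rw [hK]
    have := norm_diagGrad_sub_le hF X (consensus xs)
    rwa [diagGrad_consensus, hxs, sub_zero] at this
  calc ‖field J G p H X‖ ≤ ‖p.α • lapState G H‖ + ‖p.ε • embed (diagGrad J X)‖ := by
        rw [field, ← norm_neg (p.α • lapState G H)]
        exact norm_sub_le _ _
    _ = p.α * ‖lapState G (H - consensus xs)‖ + p.ε * ‖diagGrad J X‖ := by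
        rw [norm_smul, norm_smul, norm_embed, Real.norm_of_nonneg hα, Real.norm_of_nonneg hε,
          hlapH]
    _ ≤ p.α * (K.lamN * ‖H - consensus xs‖) + p.ε * (K.θ * ‖X - consensus xs‖) := by
        gcongr
        exact norm_lapState_le_lamN hK _
    _ = _ := by ring

theorem sampledDissipative_field {hN : 2 ≤ N} (hG : G.graph.Preconnected)
    (hF : MapAssumption J μ θown θoth) (hxs : gameMap J xs = 0) (hε : 0 < p.ε) (hα : 0 ≤ p.α)
    (hK : K = consts hN n G μ θown θoth M M') :
    SampledDissipative (field J G p) (consensus xs) (p.ε * nu K p / 2) (p.α * K.lamN)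
      (p.ε * K.θ) := by
  refine ⟨fun H X => ?_, fun H X => ?_⟩
  · have hsplit : field J G p H X = field J G p X X - p.α • lapState G (H - X) := by
      rw [field, field, map_sub, smul_sub]
      abel
    have hself := inner_field_self_le hG hF hxs hε hα hK X
    calc inner ℝ (X - consensus xs) (field J G p H X)
        = inner ℝ (X - consensus xs) (field J G p X X)
            - p.α * inner ℝ (X - consensus xs) (lapState G (H - X)) := by
          rw [hsplit, inner_sub_right, real_inner_smul_right]
      _ ≤ -(p.ε * nu K p / 2) * ‖X - consensus xs‖ ^ 2
            - p.α * -(‖X - consensus xs‖ * (K.lamN * ‖H - X‖)) := by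
          gcongr
          exact (neg_le_neg (by gcongr; exact norm_lapState_le_lamN hK _)).trans
            (neg_le_of_abs_le (abs_real_inner_le_norm _ _))
      _ = _ := by ring
  · exact norm_field_le hF hxs hε.le hα hK H X

end Dissipativity

section Convergence

variable {N : ℕ} {n : Fin N → ℕ} {J : Fin N → Profile n → ℝ} {G : WGraph N} {μ : ℝ}
  {θown θoth : Fin N → ℝ} {M M' : ℝ} {K : Consts} {p : Params} {xs : Profile n}

/-- The signs of the constants attached to a game on a connected graph. -/
structure Consts.Positive (K : Consts) : Prop where
  N_pos : 0 < K.N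
  mu_pos : 0 < K.μ
  theta_nonneg : 0 ≤ K.θ
  lam2_pos : 0 < K.lam2
  lamN_pos : 0 < K.lamN
  M₀_pos : 0 < K.M₀

theorem consts_positive {hN : 2 ≤ N} (hG : G.graph.Preconnected)
    (hF : MapAssumption J μ θown θoth) (hM₀ : 0 < M + M')
    (hK : K = consts hN n G μ θown θoth M M') : K.Positive := by
  subst hK
  exact
    { N_pos := two_pos.trans_le hN
      mu_pos := hF.mu_pos
      theta_nonneg := lipConst_nonneg _ _
      lam2_pos := WGraph.sortedEig_lap_pos hG one_ne_zero
      lamN_pos := WGraph.sortedEig_lap_pos hG (Nat.sub_ne_zero_of_lt hN)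
      M₀_pos := hM₀ }

theorem Consts.Positive.alpha_pos (hpos : K.Positive) (hε : 0 < p.ε)
    (hα : p.ε / K.lam2 * (K.θ ^ 2 / K.μ + K.θ) < p.α) : 0 < p.α := by
  have := hpos.mu_pos
  have := hpos.lam2_pos
  have := hpos.theta_nonneg
  exact hα.trans_le' (by positivity)

theorem Consts.Positive.nu_pos (hpos : K.Positive) (hε : 0 < p.ε)
    (hα : p.ε / K.lam2 * (K.θ ^ 2 / K.μ + K.θ) < p.α) : 0 < nu K p := by
  refine QNash.nu_pos hpos.N_pos hpos.mu_pos ?_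
  rw [lt_div_iff₀ hε, ← div_lt_iff₀ hpos.lam2_pos]
  exact hα.trans_eq' (by ring)

/-- The pull towards the equilibrium relative to the sensitivity of the dynamics to hold errors. -/
noncomputable def gain (K : Consts) (p : Params) : ℝ := p.ε * nu K p / (p.α * K.lamN)

/-- The hold error guaranteed at a sampling instant, relative to the distance bound. -/
noncomputable def freshError (K : Consts) (p : Params) : ℝ := gain K p * (√(1 - p.β) / 2)

/-- The hold error tolerated between sampling instants, relative to the distance bound: the value
for which the pull `ε ν / 2` still beats the perturbation by `γ`. -/
noncomputable def staleError (K : Consts) (p : Params) : ℝ := gain K p * (1 / 2 - p.β / 4)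

/-- A bound for the Euclidean distance from an initial state to the equilibrium. -/
noncomputable def radius (K : Consts) : ℝ := √((K.N : ℝ) * K.n) * K.M₀

/-- Admissible parameters for which, moreover, the state moves so little within a sampling period
that the hold error does not outgrow `staleError` and the quantizer does not saturate. -/
structure WellSampled (K : Consts) (p : Params) : Prop extends Admissible K p where
  short : p.ε * K.θ * p.T ≤ 1 / 2
  drift : Real.exp (rate K p * p.T) * (freshError K p
    + 2 * (p.α * K.lamN * (freshError K p + 1) + p.ε * K.θ) * p.T) ≤ staleError K p
  unsaturated : staleError K p * radius K ≤ (p.L + 1 / 2) * scale K p 0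

theorem Consts.Positive.gain_pos (hpos : K.Positive) (hε : 0 < p.ε)
    (hα : p.ε / K.lam2 * (K.θ ^ 2 / K.μ + K.θ) < p.α) : 0 < gain K p :=
  div_pos (mul_pos hε (hpos.nu_pos hε hα)) (mul_pos (hpos.alpha_pos hε hα) hpos.lamN_pos)

theorem Consts.Positive.rate_pos (hpos : K.Positive) (hp : Admissible K p) : 0 < rate K p :=
  div_pos (mul_pos (mul_pos hp.eps_pos (hpos.nu_pos hp.eps_pos hp.alpha_gt)) hp.beta_mem.1) four_pos

theorem alpha_mul_lamN_mul_staleError (hα : p.α ≠ 0) (hlam : K.lamN ≠ 0) :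
    p.α * K.lamN * staleError K p = p.ε * nu K p / 2 - rate K p := by
  rw [staleError, gain, rate]
  field_simp

theorem scale_zero (K : Consts) (p : Params) :
    scale K p 0 = gain K p * K.M₀ * √(1 - p.β)
      / Real.exp (rate K p * p.T + p.α * K.lamN * p.T) := by
  rw [scale, Nat.cast_zero, mul_zero, zero_mul, Real.exp_zero, mul_one,
    div_eq_mul_inv _ (Real.exp _), ← Real.exp_neg, gain]
  ring_nf

theorem scale_eq_mul_exp (K : Consts) (p : Params) (k : ℕ) :
    scale K p k = scale K p 0 * Real.exp (-rate K p * (k * p.T)) := by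
  simp only [scale, Nat.cast_zero, mul_zero, zero_mul, Real.exp_zero, mul_one, mul_assoc]

theorem Consts.Positive.scale_pos (hpos : K.Positive) (hp : Admissible K p) (k : ℕ) :
    0 < scale K p k := by
  have := hpos.gain_pos hp.eps_pos hp.alpha_gt
  have := hpos.M₀_pos
  have : 0 < √(1 - p.β) := Real.sqrt_pos.2 (sub_pos.2 hp.beta_mem.2)
  rw [scale_eq_mul_exp, scale_zero]
  positivity

theorem Consts.Positive.sqrt_mul_half_scale_le (hpos : K.Positive) (hp : Admissible K p) (k : ℕ) :
    √((K.N : ℝ) * K.n) * (scale K p k / 2)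
      ≤ freshError K p * radius K * Real.exp (-rate K p * (k * p.T)) := by
  have := hpos.gain_pos hp.eps_pos hp.alpha_gt
  have := hpos.M₀_pos
  have := hpos.lamN_pos
  have := hpos.rate_pos hp
  have := hpos.alpha_pos hp.eps_pos hp.alpha_gt
  have := hp.T_pos
  have hscale : scale K p 0 ≤ gain K p * K.M₀ * √(1 - p.β) := by
    rw [scale_zero]
    exact div_le_self (by positivity) (Real.one_le_exp (by positivity))
  calc √((K.N : ℝ) * K.n) * (scale K p k / 2)
      = √((K.N : ℝ) * K.n) * (scale K p 0 / 2) * Real.exp (-rate K p * (k * p.T)) := by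
        rw [scale_eq_mul_exp]
        ring
    _ ≤ √((K.N : ℝ) * K.n) * (gain K p * K.M₀ * √(1 - p.β) / 2)
          * Real.exp (-rate K p * (k * p.T)) := by gcongr
    _ = _ := by
        rw [freshError, radius]
        ring

theorem norm_sub_consensus_le_radius {hN : 2 ≤ N} (hK : K = consts hN n G μ θown θoth M M')
    (hM₀ : 0 ≤ M + M') (hM' : SupBound M' xs) {x₀ : Fin N → Profile n}
    (hx₀ : ∀ i, SupBound M (x₀ i)) :
    ‖(WithLp.toLp 2 x₀ : State n) - consensus xs‖ ≤ radius K := by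
  subst hK
  exact norm_le_of_forall_abs_le hM₀ fun i k c =>
    (abs_sub _ _).trans (add_le_add (hx₀ i k c) (hM' k c))

theorem norm_requantize_zero_sub_le {hN : 2 ≤ N} (hK : K = consts hN n G μ θown θoth M M')
    (hpos : K.Positive) (hp : Admissible K p) (hM' : SupBound M' xs) {x₀ : Fin N → Profile n}
    (hx₀ : ∀ i, SupBound M (x₀ i)) :
    ‖requantize p.L (scale K p 0) (WithLp.toLp 2 x₀) 0 - WithLp.toLp 2 x₀‖
      ≤ freshError K p * radius K := by
  have hs := hpos.scale_pos hp 0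
  have hround := hpos.sqrt_mul_half_scale_le hp 0
  rw [Nat.cast_zero, zero_mul, mul_zero, Real.exp_zero, mul_one] at hround
  subst hK
  refine (norm_requantize_sub_le hs fun i k c => ?_).trans hround
  have hM'_nonneg : 0 ≤ M' := (abs_nonneg _).trans (hM' k c)
  calc |x₀ i k c - 0| ≤ M := by simpa using hx₀ i k c
    _ ≤ M + M' := le_add_of_nonneg_right hM'_nonneg
    _ ≤ p.L * scale _ p 0 := (div_le_iff₀ hs).1 hp.L_ge_init
    _ ≤ (p.L + 1 / 2) * scale _ p 0 := by gcongr; linarith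

theorem norm_hatState_succ_sub_le {hN : 2 ≤ N} (hK : K = consts hN n G μ θown θoth M M')
    (hpos : K.Positive) (hp : WellSampled K p) {x : ℝ → Fin N → Profile n} {k : ℕ}
    (h : ‖hatState K p x k - WithLp.toLp 2 (x ((k + 1 : ℕ) * p.T))‖
      ≤ staleError K p * radius K * Real.exp (-rate K p * ((k + 1 : ℕ) * p.T))) :
    ‖hatState K p x (k + 1) - WithLp.toLp 2 (x ((k + 1 : ℕ) * p.T))‖
      ≤ freshError K p * radius K * Real.exp (-rate K p * ((k + 1 : ℕ) * p.T)) := by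
  have hs := hpos.scale_pos hp.toAdmissible (k + 1)
  have hround := hpos.sqrt_mul_half_scale_le hp.toAdmissible (k + 1)
  rw [hatState_succ]
  subst hK
  refine (norm_requantize_sub_le hs fun i j c => ?_).trans hround
  rw [abs_sub_comm, scale_eq_mul_exp, ← mul_assoc]
  exact (abs_apply_apply_le_norm (hatState _ p x k - WithLp.toLp 2 (x ((k + 1 : ℕ) * p.T)))
    i j c).trans (h.trans (mul_le_mul_of_nonneg_right hp.unsaturated (Real.exp_pos _).le))

theorem IsTrajectory.norm_sub_consensus_le {hN : 2 ≤ N}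
    (hK : K = consts hN n G μ θown θoth M M') (hG : G.graph.Preconnected)
    (hF : MapAssumption J μ θown θoth) (hM₀ : 0 < M + M') (hxs : gameMap J xs = 0)
    (hM' : SupBound M' xs) (hp : WellSampled K p) {x : ℝ → Fin N → Profile n}
    (hx : IsTrajectory J G K p x) (hx₀ : ∀ i, SupBound M (x 0 i)) {t : ℝ} (ht : 0 ≤ t) :
    ‖(WithLp.toLp 2 (x t) : State n) - consensus xs‖
      ≤ radius K * Real.exp (-rate K p * t) := by
  have hpos := consts_positive hG hF hM₀ hK
  have hα := hpos.alpha_pos hp.eps_pos hp.alpha_gt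
  have hfresh : 0 ≤ freshError K p :=
    mul_nonneg (hpos.gain_pos hp.eps_pos hp.alpha_gt).le (by positivity)
  have hrate_le : rate K p ≤ p.ε * nu K p / 2 := by
    have := mul_pos hp.eps_pos (hpos.nu_pos hp.eps_pos hp.alpha_gt)
    rw [rate]
    nlinarith [hp.beta_mem.2]
  refine (sampledDissipative_field hG hF hxs hp.eps_pos hα.le hK).norm_le_mul_exp
    (mul_pos hα hpos.lamN_pos).le (mul_nonneg hp.eps_pos.le hpos.theta_nonneg) hfresh
    (hpos.rate_pos hp.toAdmissible).le hrate_le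
    (alpha_mul_lamN_mul_staleError hα.ne' hpos.lamN_pos.ne') hp.T_pos
    (hp.short.trans (by norm_num)) hp.drift
    hx.continuousOn_state (fun k t ht => hx.hasDerivWithinAt_state k ht)
    (norm_sub_consensus_le_radius hK hM₀.le hM' hx₀) ?_
    (fun k => norm_hatState_succ_sub_le hK hpos hp) ht
  rw [hatState_zero]
  exact norm_requantize_zero_sub_le hK hpos hp.toAdmissible hM' hx₀

theorem expConverges_of_wellSampled {hN : 2 ≤ N} (hK : K = consts hN n G μ θown θoth M M')
    (hG : G.graph.Preconnected) (hF : MapAssumption J μ θown θoth) (hM₀ : 0 < M + M')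
    (hxs : gameMap J xs = 0) (hM' : SupBound M' xs) (hp : WellSampled K p) :
    ExpConverges J G K p M xs := by
  have hshort : p.ε * lipConst θown θoth * p.T ≤ 1 / 2 := by
    have := hp.short
    rwa [hK] at this
  refine ⟨(consts_positive hG hF hM₀ hK).rate_pos hp.toAdmissible, radius K, fun x₀ hx₀ =>
    ⟨exists_isTrajectory hF G _ hp.eps_pos.le hp.T_pos hshort x₀, ?_⟩⟩
  rintro x hx rfl i t ht
  exact (PiLp.norm_apply_le ((WithLp.toLp 2 (x t) : State n) - consensus xs) i).trans
    (hx.norm_sub_consensus_le hK hG hF hM₀ hxs hM' hp hx₀ ht)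

end Convergence

section Design

variable {K : Consts} {p : Params} {r : ℝ}

/-- The parameters with both gains `ε` and `α` multiplied by `r`. This slows the dynamics down by
the factor `r` while `ν`, `ρ` and the relative error bounds stay the same. -/
def Params.slow (p : Params) (r : ℝ) : Params := { p with ε := r * p.ε, α := r * p.α }

theorem nu_slow (hr : r ≠ 0) : nu K (p.slow r) = nu K p :=
  nu_congr (mul_div_mul_left _ _ hr)

theorem rate_slow (hr : r ≠ 0) : rate K (p.slow r) = r * rate K p := by
  rw [rate, nu_slow hr, rate, Params.slow]
  ring

theorem gain_slow (hr : r ≠ 0) : gain K (p.slow r) = gain K p := by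
  rw [gain, nu_slow hr, gain, Params.slow, mul_assoc, mul_assoc, mul_div_mul_left _ _ hr]

theorem freshError_slow (hr : r ≠ 0) : freshError K (p.slow r) = freshError K p := by
  rw [freshError, gain_slow hr, freshError, Params.slow]

theorem staleError_slow (hr : r ≠ 0) : staleError K (p.slow r) = staleError K p := by
  rw [staleError, gain_slow hr, staleError, Params.slow]

theorem rho_slow (hr : r ≠ 0) : rho K (p.slow r) = rho K p := by
  rw [rho, nu_slow hr, rho, Params.slow]
  field_simp

theorem freshError_lt_staleError (hgain : 0 < gain K p) (hβ : p.β ∈ Ioo (0 : ℝ) 1) :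
    freshError K p < staleError K p := by
  obtain ⟨hβ₀, hβ₁⟩ := hβ
  have hsqrt : √(1 - p.β) < 1 - p.β / 2 := by
    rw [Real.sqrt_lt' (by linarith)]
    nlinarith
  exact mul_lt_mul_of_pos_left (by linarith) hgain

theorem eventually_samplingCondition_slow (ha₁ : 0 < p.a₁) :
    ∀ᶠ r in 𝓝[>] (0 : ℝ), SamplingCondition K (p.slow r) := by
  have hα : Tendsto (fun r => Real.exp (r * (p.α * K.lamN * p.T)) - 1) (𝓝[>] 0) (𝓝 0) := by
    refine tendsto_nhdsWithin_of_tendsto_nhds (Continuous.tendsto' (by fun_prop) _ _ ?_)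
    rw [zero_mul, Real.exp_zero, sub_self]
  have hγ : Tendsto (fun r => r⁻¹ * (Real.exp (r * (rate K p * p.T)) - 1)) (𝓝[>] 0)
      (𝓝 (rate K p * p.T)) := by
    have hderiv := ((hasDerivAt_id (0 : ℝ)).mul_const (rate K p * p.T)).exp
    simpa using hderiv.tendsto_slope_zero_right
  have hlim := (hα.mul hγ).mul_const (rho K p * p.ε⁻¹)
  rw [zero_mul, zero_mul] at hlim
  filter_upwards [hlim.eventually_lt_const ha₁, self_mem_nhdsWithin] with r hlt hr
  rw [SamplingCondition, rate_slow hr.ne', rho_slow hr.ne']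
  refine hlt.le.trans_eq' ?_
  simp only [Params.slow, mul_inv]
  ring_nf

theorem eventually_exp_slow_le_two (K : Consts) (p : Params) :
    ∀ᶠ r in 𝓝[>] (0 : ℝ), Real.exp (rate K (p.slow r) * (p.slow r).T
      + (p.slow r).α * K.lamN * (p.slow r).T) ≤ 2 := by
  have hlim : Tendsto (fun r => Real.exp (r * rate K p * p.T + r * p.α * K.lamN * p.T)) (𝓝 0)
      (𝓝 1) := Continuous.tendsto' (by fun_prop) _ _ (by simp)
  filter_upwards [nhdsWithin_le_nhds (hlim.eventually_lt_const one_lt_two), self_mem_nhdsWithin]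
    with r hlt hr
  rw [rate_slow hr.ne']
  exact hlt.le

theorem eventually_short_slow (K : Consts) (p : Params) :
    ∀ᶠ r in 𝓝[>] (0 : ℝ), (p.slow r).ε * K.θ * (p.slow r).T ≤ 1 / 2 := by
  have hlim : Tendsto (fun r => r * p.ε * K.θ * p.T) (𝓝 0) (𝓝 0) :=
    Continuous.tendsto' (by fun_prop) _ _ (by simp)
  filter_upwards [nhdsWithin_le_nhds (hlim.eventually_lt_const one_half_pos)] with r hlt
  exact hlt.le

theorem eventually_drift_slow (h : freshError K p < staleError K p) :
    ∀ᶠ r in 𝓝[>] (0 : ℝ), Real.exp (rate K (p.slow r) * (p.slow r).T) * (freshError K (p.slow r)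
      + 2 * ((p.slow r).α * K.lamN * (freshError K (p.slow r) + 1) + (p.slow r).ε * K.θ)
        * (p.slow r).T) ≤ staleError K (p.slow r) := by
  have hlim : Tendsto (fun r => Real.exp (r * rate K p * p.T) * (freshError K p
      + 2 * (r * p.α * K.lamN * (freshError K p + 1) + r * p.ε * K.θ) * p.T)) (𝓝 0)
      (𝓝 (freshError K p)) := Continuous.tendsto' (by fun_prop) _ _ (by simp)
  filter_upwards [nhdsWithin_le_nhds (hlim.eventually_lt_const h), self_mem_nhdsWithin]
    with r hlt hr
  rw [rate_slow hr.ne', freshError_slow hr.ne', staleError_slow hr.ne']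
  exact hlt.le

/-- A number of quantization levels that suffices as soon as `e^{γ T + α λ_N T} ≤ 2`. The three
terms cover, in this order, the initial state, the inter-sample error, and the design rule for `L`
in terms of `a₂`. -/
noncomputable def sufficientLevels (K : Consts) (p : Params) : ℝ :=
  max (max (2 / (gain K p * √(1 - p.β))) (√((K.N : ℝ) * K.n) / √(1 - p.β)))
    (√((K.N : ℝ) * K.n) / p.a₂)

theorem sufficientLevels_slow (hr : r ≠ 0) :
    sufficientLevels K (p.slow r) = sufficientLevels K p := by
  rw [sufficientLevels, gain_slow hr, sufficientLevels, Params.slow]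

theorem M₀_div_scale_zero_le (hM₀ : 0 < K.M₀) (hgain : 0 < gain K p) (hβ : p.β < 1)
    (hexp : Real.exp (rate K p * p.T + p.α * K.lamN * p.T) ≤ 2)
    (hL : sufficientLevels K p ≤ p.L) : K.M₀ / scale K p 0 ≤ p.L := by
  have : 0 < √(1 - p.β) := Real.sqrt_pos.2 (sub_pos.2 hβ)
  calc K.M₀ / scale K p 0
      = Real.exp (rate K p * p.T + p.α * K.lamN * p.T) / (gain K p * √(1 - p.β)) := by
        rw [scale_zero]
        field_simp
    _ ≤ 2 / (gain K p * √(1 - p.β)) := by gcongr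
    _ ≤ p.L := ((le_max_left _ _).trans (le_max_left _ _)).trans hL

theorem ceil_le_of_sufficientLevels_le (ha₂ : 0 < p.a₂)
    (hexp : Real.exp (rate K p * p.T + p.α * K.lamN * p.T) ≤ 2)
    (hL : sufficientLevels K p ≤ p.L) :
    ⌈√((K.N : ℝ) * K.n) * Real.exp (p.ε * nu K p * p.β * p.T / 4 + p.α * K.lamN * p.T) /
      (2 * p.a₂) - 1 / 2⌉ ≤ (p.L : ℤ) := by
  rw [Int.ceil_le, Int.cast_natCast, mul_div_right_comm _ p.T, ← rate]
  calc √((K.N : ℝ) * K.n) * Real.exp (rate K p * p.T + p.α * K.lamN * p.T) / (2 * p.a₂) - 1 / 2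
      ≤ √((K.N : ℝ) * K.n) * 2 / (2 * p.a₂) := by
        refine (sub_le_self _ one_half_pos.le).trans ?_
        gcongr
    _ = √((K.N : ℝ) * K.n) / p.a₂ := by field_simp
    _ ≤ p.L := (le_max_right _ _).trans hL

theorem staleError_mul_radius_le (hM₀ : 0 ≤ K.M₀) (hgain : 0 ≤ gain K p)
    (hβ : p.β ∈ Ioo (0 : ℝ) 1) (hexp : Real.exp (rate K p * p.T + p.α * K.lamN * p.T) ≤ 2)
    (hL : sufficientLevels K p ≤ p.L) :
    staleError K p * radius K ≤ (p.L + 1 / 2) * scale K p 0 := by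
  obtain ⟨hβ₀, hβ₁⟩ := hβ
  have hsqrt : 0 < √(1 - p.β) := Real.sqrt_pos.2 (sub_pos.2 hβ₁)
  have hlevels : √((K.N : ℝ) * K.n) ≤ p.L * √(1 - p.β) :=
    (div_le_iff₀ hsqrt).1 (((le_max_right _ _).trans (le_max_left _ _)).trans hL)
  rw [scale_zero, mul_div_assoc', le_div_iff₀ (Real.exp_pos _), staleError, radius]
  calc _ ≤ gain K p * (1 / 2) * (√((K.N : ℝ) * K.n) * K.M₀) * 2 := by
        gcongr
        linarith
    _ = √((K.N : ℝ) * K.n) * (gain K p * K.M₀) := by ring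
    _ ≤ (p.L + 1 / 2) * √(1 - p.β) * (gain K p * K.M₀) := by
        gcongr
        exact hlevels.trans (by gcongr; linarith)
    _ = _ := by ring

theorem eventually_wellSampled_slow (hpos : K.Positive) (hε : 0 < p.ε) (hT : 0 < p.T)
    (hα : p.ε / K.lam2 * (K.θ ^ 2 / K.μ + K.θ) < p.α) (hβ : p.β ∈ Ioo (0 : ℝ) 1)
    (ha₁ : p.a₁ ∈ Ioo (0 : ℝ) 1) (ha₂ : p.a₂ ∈ Ioo (0 : ℝ) (1 - p.a₁)) (hLpos : 0 < p.L)
    (hL : sufficientLevels K p ≤ p.L) : ∀ᶠ r in 𝓝[>] (0 : ℝ), WellSampled K (p.slow r) := by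
  have hgain := hpos.gain_pos hε hα
  filter_upwards [eventually_samplingCondition_slow ha₁.1, eventually_exp_slow_le_two K p,
    eventually_short_slow K p, eventually_drift_slow (freshError_lt_staleError hgain hβ),
    self_mem_nhdsWithin] with r hsampling hexp hshort hdrift hr
  rw [← sufficientLevels_slow hr.ne'] at hL
  rw [← gain_slow hr.ne'] at hgain
  exact
    { eps_pos := mul_pos hr hε
      T_pos := hT
      alpha_gt := (mul_lt_mul_of_pos_left hα hr).trans_eq' (by rw [Params.slow]; ring)
      beta_mem := hβ
      a₁_mem := ha₁
      a₂_mem := ha₂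
      sampling := hsampling
      L_pos := hLpos
      L_ge_init := M₀_div_scale_zero_le hpos.M₀_pos hgain hβ.2 hexp hL
      L_ge := ceil_le_of_sufficientLevels_le ha₂.1 hexp hL
      short := hshort
      drift := hdrift
      unsaturated := staleError_mul_radius_le hpos.M₀_pos.le hgain.le hβ hexp hL }

theorem exists_levels_forall_eventually_wellSampled (hpos : K.Positive) {c β a₁ a₂ : ℝ}
    (hc : 1 / K.lam2 * (K.θ ^ 2 / K.μ + K.θ) < c) (hβ : β ∈ Ioo (0 : ℝ) 1)
    (ha₁ : a₁ ∈ Ioo (0 : ℝ) 1) (ha₂ : a₂ ∈ Ioo (0 : ℝ) (1 - a₁)) :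
    ∃ L : ℕ, 0 < L ∧ ∀ T : ℝ, 0 < T →
      ∀ᶠ ε in 𝓝[>] (0 : ℝ), WellSampled K ⟨ε, c * ε, β, a₁, a₂, T, L⟩ := by
  obtain ⟨L, hL⟩ := exists_nat_ge (max 1 (sufficientLevels K ⟨1, c, β, a₁, a₂, 1, 1⟩))
  obtain ⟨hL₁, hL⟩ := max_le_iff.1 hL
  have hLpos : 0 < L := by exact_mod_cast hL₁
  refine ⟨L, hLpos, fun T hT => ?_⟩
  simpa only [Params.slow, mul_one, mul_comm c] using
    eventually_wellSampled_slow (p := ⟨1, c, β, a₁, a₂, T, L⟩) hpos one_pos hT hc hβ ha₁ ha₂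
      hLpos hL

theorem bitsPerSample_pos {L : ℕ} (hn : 0 < K.n) (hL : 0 < L) : 0 < bitsPerSample K L := by
  have : (0 : ℝ) < L := Nat.cast_pos.2 hL
  exact mul_pos (Nat.cast_pos.2 hn) (Real.logb_pos one_lt_two (by linarith))

theorem exists_wellSampled_bitsPerSample_div_eq (hpos : K.Positive) (hn : 0 < K.n) {B : ℝ}
    (hB : 0 < B) : ∃ p, WellSampled K p ∧ bitsPerSample K p.L / p.T = B := by
  obtain ⟨L, hL, hwell⟩ := exists_levels_forall_eventually_wellSampled hpos (lt_add_one _)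
    (β := 1 / 2) (a₁ := 1 / 2) (a₂ := 1 / 4) (by norm_num) (by norm_num) (by norm_num)
  have hbits := bitsPerSample_pos hn hL
  obtain ⟨ε, hε⟩ := (hwell (bitsPerSample K L / B) (div_pos hbits hB)).exists
  exact ⟨_, hε, div_div_cancel₀ hbits.ne'⟩

end Design

end QNash

theorem theorem2 {N : ℕ} (hN : 2 ≤ N) (n : Fin N → ℕ) (hn : 0 < ∑ i, n i)
    (J : Fin N → QNash.Profile n → ℝ) (G : QNash.WGraph N) (hG : G.graph.Connected)
    (μ : ℝ) (θown θoth : Fin N → ℝ)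
    (hJ : QNash.CostAssumption J) (hF : QNash.MapAssumption J μ θown θoth)
    (M M' : ℝ) (hM₀ : 0 < M + M')
    (hM' : ∀ x, QNash.IsNash J x → QNash.SupBound M' x)
    (K : QNash.Consts) (hK : K = QNash.consts hN n G μ θown θoth M M') :
    ∃ xs : QNash.Profile n, QNash.IsNash J xs ∧ (∀ y, QNash.IsNash J y → y = xs) ∧
      -- every positive bandwidth is attained by an exponentially convergent design
      (∀ B : ℝ, 0 < B → ∃ p : QNash.Params, QNash.Admissible K p ∧
        QNash.algBandwidth G K p = (B : EReal) ∧ QNash.ExpConverges J G K p M xs) ∧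
      -- with `α = c ε`, one number `L` of levels serves every `T`, once `ε` is small
      (∀ c β a₁ a₂ : ℝ, 1 / K.lam2 * (K.θ ^ 2 / K.μ + K.θ) < c →
        β ∈ Set.Ioo (0 : ℝ) 1 → a₁ ∈ Set.Ioo (0 : ℝ) 1 → a₂ ∈ Set.Ioo (0 : ℝ) (1 - a₁) →
        ∃ L : ℕ, ∀ T : ℝ, 0 < T → ∃ ε₀ : ℝ, 0 < ε₀ ∧ ∀ ε : ℝ, 0 < ε → ε < ε₀ →
          ∀ p : QNash.Params, p = ⟨ε, c * ε, β, a₁, a₂, T, L⟩ →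
            QNash.Admissible K p ∧
            QNash.algBandwidth G K p = ((QNash.bitsPerSample K L / T : ℝ) : EReal) ∧
            QNash.ExpConverges J G K p M xs) := by
  have hpos := QNash.consts_positive hG.preconnected hF hM₀ hK
  have hNash (x) : QNash.IsNash J x ↔ QNash.gameMap J x = 0 :=
    QNash.isNash_iff_gameMap_eq_zero (fun i x => (hJ.strictConvex i x).convexOn)
      fun i x => (hJ.contDiff i x).differentiable one_ne_zero
  obtain ⟨xs, hzero, hunique⟩ := QNash.existsUnique_gameMap_eq_zero hF
  have hxs := (hNash xs).2 hzero
  have hdesign {p} (hp : QNash.WellSampled K p) : QNash.Admissible K p ∧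
      QNash.algBandwidth G K p = ((QNash.bitsPerSample K p.L / p.T : ℝ) : EReal) ∧
      QNash.ExpConverges J G K p M xs :=
    ⟨hp.toAdmissible, QNash.algBandwidth_eq hN hG.preconnected K hp.T_pos,
      QNash.expConverges_of_wellSampled hK hG.preconnected hF hM₀ hzero
        (hM' xs hxs) hp⟩
  refine ⟨xs, hxs, fun y hy => hunique y ((hNash y).1 hy), fun B hB => ?_,
    fun c β a₁ a₂ hc hβ ha₁ ha₂ => ?_⟩
  · obtain ⟨p, hp, rfl⟩ :=
      QNash.exists_wellSampled_bitsPerSample_div_eq hpos (by rwa [hK]) hB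
    exact ⟨p, hdesign hp⟩
  · obtain ⟨L, -, hwell⟩ :=
      QNash.exists_levels_forall_eventually_wellSampled hpos hc hβ ha₁ ha₂
    refine ⟨L, fun T hT => ?_⟩
    obtain ⟨ε₀, hε₀, hsub⟩ := mem_nhdsGT_iff_exists_Ioo_subset.1 (hwell T hT)
    exact ⟨ε₀, hε₀, fun ε hε hlt p hp => hp ▸ hdesign (hsub ⟨hε, hlt⟩)⟩
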